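/- Let $J^\infty\in L^1(\mathbb R)$ be nonnegative and even with $\int_{\mathbb R}J^\infty>0$, and let $J(x)=\sum_{r\in\mathbb Z}J^\infty(x-r)$ be its periodisation on the circle $\mathbb T=\mathbb R/\mathbb Z$. Let $f\in C^1(\mathbb R)$ be an odd bistable nonlinearity with $f(\pm1)=0$, $f'(\pm1)<0<f'(0)$ and $f'(v)\le f'(0)$ for all $v$; the model case is $f(u)=u(1-u^2)$. For $\varepsilon\ge 0$ consider on $L^\infty(\mathbb T)$ the equation $$u_t=\varepsilon\int_0^1 J(x-y)\,(u(y,t)-u(x,t))\,dy+f(u). \qquad (*)$$ A zero-mean one-interface branch is a family $(u_\varepsilon)_{\varepsilon\in I}$ of stationary solutions of $(*)$, where $I\subset[0,\infty)$ is an interval containing $0$, such that $\varepsilon\mapsto u_\varepsilon\in L^\infty(\mathbb T)$ is continuous, $u_0=1$ a.e. on $[0,\tfrac12)$ and $u_0=-1$ a.e. on $[\tfrac12,1)$, and every $u_\varepsilon$ has mean zero and keeps the antisymmetry $u_\varepsilon(-x)=-u_\varepsilon(x)$ about the interface. For such a branch let $\varepsilon_1^s$ be the value at which, as $\varepsilon$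 decreases, the branch first becomes stable, that is, the supremum of the $\varepsilon\in I$ for which $u_\varepsilon$ is Lyapunov stable in $L^\infty(\mathbb T)$ under $(*)$. Let $\varepsilon_1^d$ be the value at which the branch becomes discontinuous, that is, the supremum of the $\varepsilon\in I$ for which $u_\varepsilon$ has no continuous representative. Then, for every zero-mean one-interface branch, both suprema are over nonempty bounded sets, $u_\varepsilon$ is discontinuous for every $\varepsilon\in I$ with $\varepsilon<\varepsilon_1^d$, and $$\varepsilon_1^s\le\varepsilon_1^d .$$ -/

import Mathlib

open MeasureTheory Set
open scoped ENNReal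

namespace NonlocalBistable

/-- The state space `L^∞` of the circle of length one, i.e. of (classes of) bounded
one-periodic functions. -/
abbrev State : Type := Lp ℝ ∞ (volume : Measure UnitAddCircle)

/-- The periodised kernel `J(x) = ∑ r, J^∞(x - r)`, as a function on the circle. -/
noncomputable def periodicKernel (Jinf : ℝ → ℝ) (x : UnitAddCircle) : ℝ :=
  ∑' r : ℤ, Jinf ((AddCircle.equivIco (1 : ℝ) 0 x : ℝ) - r)

/-- Admissible kernels on the line: integrable, nonnegative, even and not almost everywhere
zero. -/
structure IsKernel (Jinf : ℝ → ℝ) : Prop where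
  integrable : Integrable Jinf
  nonneg : ∀ x, 0 ≤ Jinf x
  even : ∀ x, Jinf (-x) = Jinf x
  mass_pos : 0 < ∫ x, Jinf x

/-- Odd bistable nonlinearities with stable zeros `1`, `-1`, unstable zero `0`, and steepest
ascent at `0`; the model case is `f u = u * (1 - u ^ 2)`. -/
structure IsOddBistable (f : ℝ → ℝ) : Prop where
  contDiff : ContDiff ℝ 1 f
  odd : ∀ v, f (-v) = -f v
  map_one : f 1 = 0
  deriv_one_neg : deriv f 1 < 0
  deriv_zero_pos : 0 < deriv f 0
  deriv_le : ∀ v, deriv f v ≤ deriv f 0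

/-- The right-hand side `ε ∫ J(x - y) (u(y) - u(x)) dy + f(u(x))` of the evolution equation. -/
noncomputable def rhs (Jinf f : ℝ → ℝ) (ε : ℝ) (u : UnitAddCircle → ℝ) (x : UnitAddCircle) : ℝ :=
  ε * (∫ y, periodicKernel Jinf (x - y) * (u y - u x)) + f (u x)

/-- Stationary solutions in `L^∞`. -/
def IsStationary (Jinf f : ℝ → ℝ) (ε : ℝ) (u : State) : Prop :=
  ∀ᵐ x, rhs Jinf f ε u x = 0

/-- `w` solves the evolution equation `u_t = ε ∫ J(x - y) (u(y) - u(x)) dy + f(u)` on the time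
interval `[0, T)`, as a differentiable curve in `L^∞` (one-sided derivative at time `0`). -/
def IsSolutionOn (Jinf f : ℝ → ℝ) (ε T : ℝ) (w : ℝ → State) : Prop :=
  ∀ t ∈ Ico 0 T, ∃ w' : State,
    HasDerivWithinAt w w' (Ici 0) t ∧ ∀ᵐ x, w' x = rhs Jinf f ε (w t) x

/-- Stability (in the sense of Lyapunov) in `L^∞` under the evolution equation. -/
def IsStable (Jinf f : ℝ → ℝ) (ε : ℝ) (u : State) : Prop :=
  ∀ η > 0, ∃ δ > 0, ∀ T > 0, ∀ w : ℝ → State, IsSolutionOn Jinf f ε T w →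
    ‖w 0 - u‖ < δ → ∀ t ∈ Ico 0 T, ‖w t - u‖ < η

/-- An element of `L^∞` is discontinuous if it has no continuous representative. -/
def IsDiscontinuous (u : State) : Prop :=
  ¬ ∃ v : UnitAddCircle → ℝ, Continuous v ∧ ∀ᵐ x, u x = v x

/-- The zero-mean one-interface profile: `1` on `[0, 1/2)` and `-1` on `[1/2, 1)`. -/
noncomputable def stepProfile (x : UnitAddCircle) : ℝ :=
  if (AddCircle.equivIco (1 : ℝ) 0 x : ℝ) < 1 / 2 then 1 else -1

/-- `u`, defined for the diffusion coefficients `ε` in the interval `I`, is a zero-mean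
one-interface branch: a curve of stationary solutions, continuous in `L^∞`, which originates at
`ε = 0` from the one-interface profile with values `1`, `-1` and keeps its mean zero and its
antisymmetry about the interface. -/
structure IsZeroMeanOneInterfaceBranch (Jinf f : ℝ → ℝ) (I : Set ℝ) (u : ℝ → State) : Prop where
  ordConnected : I.OrdConnected
  zero_mem : 0 ∈ I
  nonneg : ∀ ε ∈ I, 0 ≤ ε
  continuousOn : ContinuousOn u I
  stationary : ∀ ε ∈ I, IsStationary Jinf f ε (u ε)
  start : ∀ᵐ x, u 0 x = stepProfile x
  mean_zero : ∀ ε ∈ I, ∫ x, u ε x = 0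
  antisymm : ∀ ε ∈ I, ∀ᵐ x, u ε (-x) = -u ε x

/-- `e` is the value of `ε` at which, as `ε` decreases along the branch, the solution first
becomes stable: the least upper bound of the parameters at which it is stable. -/
def IsStabilisationValue (Jinf f : ℝ → ℝ) (I : Set ℝ) (u : ℝ → State) (e : ℝ) : Prop :=
  IsLUB {ε ∈ I | IsStable Jinf f ε (u ε)} e

/-- `e` is the value of `ε` below which the branch is discontinuous and above which it is
continuous. -/
def IsDiscontinuityValue (I : Set ℝ) (u : ℝ → State) (e : ℝ) : Prop :=
  IsLUB {ε ∈ I | IsDiscontinuous (u ε)} e ∧ ∀ ε ∈ I, ε < e → IsDiscontinuous (u ε)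

end NonlocalBistable

/-!
Write `m > 0` for the mass of the periodised kernel `J`. A bounded `u` is stationary precisely when
`ε * m * u - f u = ε * (J ∗ u)`, and the right-hand side is continuous because `J` is integrable and
`u` is bounded. The number `f' 0 / m` is a common threshold for continuity and stability.

*Above the threshold* the function `v ↦ ε * m * v - f v` is a homeomorphism of the line, since
`f' ≤ f' 0 < ε * m`, so every stationary solution is continuous
(`IsStationary.exists_continuousMap`).

*Below the threshold* this function has an isolated zero at the origin, uniformly in `ε`. By
antisymmetry `J ∗ u` vanishes at the interface, so close to the interface the values of `u` are either
small or bounded away from zero. Which alternative holds cannot change along a branch which is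
continuous in `L^∞`, and at `ε = 0` the values are `1` and `-1`; an antisymmetric function whose
values stay away from zero near the interface is discontinuous
(`IsZeroMeanOneInterfaceBranch.isDiscontinuous`).

*Stability at `ε = 0`* holds because short Euler steps of `v' = f v` near `1` and `-1` do not increase
the distance to these zeros (`isStable_zero`).

*Instability above the threshold* (`not_isStable_of_antisymm`) is proved without linearisation. If a
stationary solution `v` is stable and `M` is a subsolution close to `v`, then the solution starting
at `M` increases in time and remains close to `v`, hence it converges to a stationary solution
`U ≥ M` close to `v` (`IsStable.exists_stationary_ge`). For nonconstant `v` this is applied to the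
maximum `M` of `v` and a nearby translate. The integral of `U` is larger than that of `v`, so `U` is
no translate of `v`, and by the strong maximum principle the set of shifts `s` for which `v (· + s)`
lies below `U` is open and closed. Hence `U` lies above all translates of `v` and so above `max v`,
which is impossible once `U` is closer to `v` than the oscillation of `v`. If `v` is constant then
`v = 0` by antisymmetry, and small positive constants are subsolutions, while there is
no small positive stationary solution `U`: at a minimum of `U` the right-hand side would be positive.

Together, the discontinuity value lies between the values of `ε` in `I` below the threshold and the
threshold itself, and no stable solution occurs above the threshold.
-/

open Filter Topology

namespace NonlocalBistable

/-! ### The periodised kernel -/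

theorem tsum_sub_intCast_periodic (g : ℝ → ℝ) (t : ℝ) (n : ℤ) :
    ∑' r : ℤ, g (t + n - r) = ∑' r : ℤ, g (t - r) := by
  rw [← (Equiv.addRight n).tsum_eq (fun r : ℤ => g (t + n - r))]
  refine tsum_congr fun r => ?_
  simp only [Equiv.coe_addRight, Int.cast_add]
  congr 1; ring

/-- The periodised kernel may be computed from any representative. -/
theorem periodicKernel_coe (Jinf : ℝ → ℝ) (t : ℝ) :
    periodicKernel Jinf (t : UnitAddCircle) = ∑' r : ℤ, Jinf (t - r) := by
  obtain ⟨n, hn⟩ : ∃ n : ℤ, (AddCircle.equivIco (1 : ℝ) 0 (t : UnitAddCircle) : ℝ) = t + n := by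
    refine ⟨-toIcoDiv (one_pos : (0:ℝ) < 1) 0 t, ?_⟩
    rw [AddCircle.coe_equivIco_mk_apply]
    rw [Int.fract, ← toIcoDiv_zero_one]
    simp [sub_eq_add_neg]
  rw [periodicKernel, hn, tsum_sub_intCast_periodic]

theorem periodicKernel_nonneg {Jinf : ℝ → ℝ} (h : ∀ x, 0 ≤ Jinf x) (x : UnitAddCircle) :
    0 ≤ periodicKernel Jinf x := tsum_nonneg fun _ => h _

theorem periodicKernel_neg {Jinf : ℝ → ℝ} (h : ∀ x, Jinf (-x) = Jinf x) (x : UnitAddCircle) :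
    periodicKernel Jinf (-x) = periodicKernel Jinf x := by
  induction x using QuotientAddGroup.induction_on with
  | H t =>
    change periodicKernel Jinf (((-t : ℝ)) : UnitAddCircle) = periodicKernel Jinf (t : UnitAddCircle)
    rw [periodicKernel_coe, periodicKernel_coe, ← (Equiv.neg ℤ).tsum_eq]
    refine tsum_congr fun r => ?_
    rw [← h]
    simp only [Equiv.neg_apply, Int.cast_neg]
    congr 1; ring

/-- Unfolding: over one period, the periodisation has the integral of the function over the line. -/
theorem integral_tsum_sub_intCast {g : ℝ → ℝ} (hg : Integrable g) :
    ∫ t in Ioc (0 : ℝ) 1, ∑' r : ℤ, g (t - r) = ∫ t, g t := by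
  have hint : ∀ r : ℤ, IntegrableOn (fun t => g (t - r)) (Ioc (0 : ℝ) 1) := fun r =>
    (hg.comp_sub_right (r : ℝ)).integrableOn
  have key : ∀ k : ℝ → ℝ, Integrable k →
      HasSum (fun r : ℤ => ∫ t in Ioc (0 : ℝ) 1, k (t - r)) (∫ t, k t) := by
    intro k hk
    have := (Equiv.neg ℤ).hasSum_iff.2 hk.hasSum_intervalIntegral_comp_add_int
    have e : (fun r : ℤ => ∫ t in Ioc (0 : ℝ) 1, k (t - r)) =
        (fun n : ℤ => ∫ x in (0 : ℝ)..1, k (x + n)) ∘ Equiv.neg ℤ := by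
      funext r
      simp [intervalIntegral.integral_of_le zero_le_one, sub_eq_add_neg]
    rwa [e]
  have h1 := hasSum_integral_of_summable_integral_norm hint (key _ hg.norm).summable
  exact h1.unique (key _ hg)

theorem integral_periodicKernel {Jinf : ℝ → ℝ} (hJ : Integrable Jinf) :
    ∫ x, periodicKernel Jinf x = ∫ t, Jinf t := by
  rw [← UnitAddCircle.integral_preimage 0, zero_add, ← integral_tsum_sub_intCast hJ]
  simp only [periodicKernel_coe]

/-- Integrability comes for free, since the integral is not zero. -/
theorem integrable_periodicKernel {Jinf : ℝ → ℝ} (hJ : IsKernel Jinf) :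
    Integrable (periodicKernel Jinf) := by
  by_contra h
  have := integral_periodicKernel hJ.integrable
  rw [integral_undef h] at this
  exact hJ.mass_pos.ne this

/-! ### Convolution on the circle and the strong maximum principle -/

/-- Nonnegative, even, integrable kernels of positive mass on the circle. -/
structure IsCircleKernel (J : UnitAddCircle → ℝ) : Prop where
  integrable : Integrable J
  nonneg : ∀ x, 0 ≤ J x
  even : ∀ x, J (-x) = J x
  mass_pos : 0 < ∫ x, J x

theorem IsKernel.isCircleKernel {Jinf : ℝ → ℝ} (hJ : IsKernel Jinf) :
    IsCircleKernel (periodicKernel Jinf) where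
  integrable := integrable_periodicKernel hJ
  nonneg := periodicKernel_nonneg hJ.nonneg
  even := periodicKernel_neg hJ.even
  mass_pos := by rw [integral_periodicKernel hJ.integrable]; exact hJ.mass_pos

/-- Convolution `∫ J (x - y) φ y dy` on the circle. -/
noncomputable def circleConv (J φ : UnitAddCircle → ℝ) (x : UnitAddCircle) : ℝ :=
  ∫ y, J (x - y) * φ y

theorem memLp_top_of_continuous {φ : UnitAddCircle → ℝ} (h : Continuous φ) :
    MemLp φ ∞ volume := by
  obtain ⟨C, hC⟩ := (isCompact_univ (X := UnitAddCircle)).exists_bound_of_continuousOn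
    h.continuousOn
  exact memLp_top_of_bound h.aestronglyMeasurable C (.of_forall fun x => hC x (mem_univ x))

theorem integrable_of_memLp_top {φ : UnitAddCircle → ℝ} (h : MemLp φ ∞ volume) :
    Integrable φ := h.integrable le_top

theorem ae_abs_le_toReal_eLpNorm {φ : UnitAddCircle → ℝ} (h : MemLp φ ∞ volume) :
    ∀ᵐ y, |φ y| ≤ (eLpNorm φ ∞ volume).toReal := by
  filter_upwards [ae_le_eLpNormEssSup (f := φ) (μ := volume)] with y hy
  rw [← eLpNorm_exponent_top] at hy
  have := ENNReal.toReal_mono h.2.ne hy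
  rwa [toReal_enorm, Real.norm_eq_abs] at this

theorem State.ae_abs_le_norm (u : State) : ∀ᵐ x, |u x| ≤ ‖u‖ :=
  ae_abs_le_toReal_eLpNorm (Lp.memLp u)

theorem State.ae_abs_sub_le_norm (u v : State) : ∀ᵐ x, |u x - v x| ≤ ‖u - v‖ := by
  filter_upwards [Lp.coeFn_sub u v, State.ae_abs_le_norm (u - v)] with x h1 h2
  rwa [h1] at h2

theorem State.norm_sub_le (u v : State) {C : ℝ} (hC : 0 ≤ C) (h : ∀ᵐ x, |u x - v x| ≤ C) :
    ‖u - v‖ ≤ C := by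
  have := Lp.norm_le_of_ae_bound (f := u - v) hC (by
    filter_upwards [Lp.coeFn_sub u v, h] with x h1 h2
    rw [h1]
    exact h2)
  simpa using this

namespace IsCircleKernel

variable {J φ ψ : UnitAddCircle → ℝ}

theorem integrable_mul (hJ : IsCircleKernel J) (hφ : MemLp φ ∞ volume) (x : UnitAddCircle) :
    Integrable fun y => J (x - y) * φ y :=
  (hJ.integrable.comp_sub_left x).mul_of_top_left hφ

theorem conv_const (c : ℝ) (x : UnitAddCircle) :
    circleConv J (fun _ => c) x = (∫ y, J y) * c := by
  rw [circleConv, integral_mul_const, integral_sub_left_eq_self]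

theorem conv_congr (h : φ =ᵐ[volume] ψ) : circleConv J φ = circleConv J ψ := by
  funext x
  refine integral_congr_ae ?_
  filter_upwards [h] with y hy
  rw [hy]

theorem conv_mono (hJ : IsCircleKernel J) (hφ : MemLp φ ∞ volume) (hψ : MemLp ψ ∞ volume)
    (h : ∀ᵐ y, φ y ≤ ψ y) (x : UnitAddCircle) : circleConv J φ x ≤ circleConv J ψ x := by
  refine integral_mono_ae (hJ.integrable_mul hφ x) (hJ.integrable_mul hψ x) ?_
  filter_upwards [h] with y hy
  exact mul_le_mul_of_nonneg_left hy (hJ.nonneg _)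

theorem conv_sub (hJ : IsCircleKernel J) (hφ : MemLp φ ∞ volume) (hψ : MemLp ψ ∞ volume)
    (x : UnitAddCircle) :
    circleConv J (fun y => φ y - ψ y) x = circleConv J φ x - circleConv J ψ x := by
  simp only [circleConv, mul_sub]
  exact integral_sub (hJ.integrable_mul hφ x) (hJ.integrable_mul hψ x)

theorem abs_conv_le (hJ : IsCircleKernel J) (hφ : MemLp φ ∞ volume) {C : ℝ}
    (h : ∀ᵐ y, |φ y| ≤ C) (x : UnitAddCircle) :
    |circleConv J φ x| ≤ (∫ y, J y) * C := by
  rw [← conv_const (J := J) C x, circleConv, circleConv]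
  refine (abs_integral_le_integral_abs).trans ?_
  refine integral_mono_ae (hJ.integrable_mul hφ x).abs
    ((hJ.integrable.comp_sub_left x).mul_const C) ?_
  filter_upwards [h] with y hy
  rw [abs_mul, abs_of_nonneg (hJ.nonneg _)]
  exact mul_le_mul_of_nonneg_left hy (hJ.nonneg _)

theorem abs_conv_sub_le (hJ : IsCircleKernel J) (hφ : MemLp φ ∞ volume)
    (hψ : MemLp ψ ∞ volume) {C : ℝ} (h : ∀ᵐ y, |φ y - ψ y| ≤ C) (x : UnitAddCircle) :
    |circleConv J φ x - circleConv J ψ x| ≤ (∫ y, J y) * C := by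
  rw [← hJ.conv_sub hφ hψ]
  exact hJ.abs_conv_le (hφ.sub hψ) h x

theorem conv_translate (s x : UnitAddCircle) :
    circleConv J (fun y => φ (y + s)) x = circleConv J φ (x + s) := by
  rw [circleConv, circleConv, ← integral_add_right_eq_self (fun y => J (x + s - y) * φ y) s]
  simp only [add_sub_add_right_eq_sub]

theorem conv_neg (hJ : IsCircleKernel J) (x : UnitAddCircle) :
    circleConv J (fun y => φ (-y)) x = circleConv J φ (-x) := by
  rw [circleConv, circleConv, ← integral_neg_eq_self]
  refine integral_congr_ae (.of_forall fun y => ?_)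
  simp only [neg_neg]
  rw [← hJ.even (x - -y)]
  congr 2; abel

/-- Convolution with a bounded function is continuous: approximate the kernel in `L¹` by continuous
functions, which makes the convolutions converge uniformly. -/
theorem continuous_conv (hJ : IsCircleKernel J) (hφ : MemLp φ ∞ volume) :
    Continuous (circleConv J φ) := by
  obtain ⟨C, hC0, hC⟩ : ∃ C > 0, ∀ᵐ y, |φ y| ≤ C :=
    ⟨(eLpNorm φ ∞ volume).toReal + 1, by positivity,
      (ae_abs_le_toReal_eLpNorm hφ).mono fun y hy => by linarith⟩
  refine continuous_of_uniform_approx_of_continuous fun V hV => ?_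
  obtain ⟨ε, hε, hεV⟩ := Metric.mem_uniformity_dist.1 hV
  obtain ⟨g, hg, hgi⟩ := hJ.integrable.exists_boundedContinuous_integral_sub_le
    (ε := ε / (2 * C)) (by positivity)
  refine ⟨circleConv g φ, ?_, fun x => hεV ?_⟩
  · refine continuous_of_dominated (bound := fun y => ‖g‖ * |φ y|) (fun x => ?_) (fun x => ?_) ?_ ?_
    · exact (by fun_prop : Continuous fun y => g (x - y)).aestronglyMeasurable.mul hφ.1
    · refine .of_forall fun y => ?_
      rw [norm_mul]
      exact mul_le_mul_of_nonneg_right (g.norm_coe_le_norm _) (abs_nonneg _)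
    · exact (integrable_of_memLp_top hφ).abs.const_mul _
    · exact .of_forall fun y => by fun_prop
  · have hgφ : Integrable fun y => g (x - y) * φ y := (hgi.comp_sub_left x).mul_of_top_left hφ
    rw [Real.dist_eq, circleConv, circleConv, ← integral_sub (hJ.integrable_mul hφ x) hgφ]
    calc |∫ y, (J (x - y) * φ y - g (x - y) * φ y)|
        ≤ ∫ y, |J (x - y) * φ y - g (x - y) * φ y| := abs_integral_le_integral_abs
      _ ≤ ∫ y, ‖J (x - y) - g (x - y)‖ * C := by
        refine integral_mono_ae ((hJ.integrable_mul hφ x).sub hgφ).abs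
          ((((hJ.integrable.sub hgi).comp_sub_left x).norm).mul_const C) ?_
        filter_upwards [hC] with y hy
        rw [← sub_mul, abs_mul]
        exact mul_le_mul_of_nonneg_left hy (abs_nonneg _)
      _ = (∫ y, ‖J y - g y‖) * C := by
        rw [integral_mul_const, integral_sub_left_eq_self fun y => ‖J y - g y‖]
      _ ≤ ε / (2 * C) * C := mul_le_mul_of_nonneg_right hg hC0.le
      _ < ε := by field_simp; norm_num

/-- Convolution with an even kernel is symmetric in `L²`. -/
theorem integral_mul_conv_comm (hJ : IsCircleKernel J) (hφ : MemLp φ ∞ volume)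
    (hψ : MemLp ψ ∞ volume) :
    ∫ x, ψ x * circleConv J φ x = ∫ x, φ x * circleConv J ψ x := by
  have hφ1 : Integrable (fun p : UnitAddCircle × UnitAddCircle => φ p.2 * J (p.1 - p.2))
      (volume.prod volume) :=
    (integrable_of_memLp_top hφ).convolution_integrand (ContinuousLinearMap.mul ℝ ℝ) hJ.integrable
  have hψ1 : MemLp (fun p : UnitAddCircle × UnitAddCircle => ψ p.1) ∞ (volume.prod volume) := by
    have := hψ.comp_fst (volume : Measure UnitAddCircle)
    simpa using this
  have hint : Integrable (fun p : UnitAddCircle × UnitAddCircle =>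
      (φ p.2 * J (p.1 - p.2)) * ψ p.1) (volume.prod volume) := hφ1.mul_of_top_left hψ1
  have := integral_integral_swap (f := fun x y => (φ y * J (x - y)) * ψ x) hint
  calc ∫ x, ψ x * circleConv J φ x = ∫ x, ∫ y, (φ y * J (x - y)) * ψ x := by
        refine integral_congr_ae (.of_forall fun x => ?_)
        simp only [circleConv]
        rw [← integral_const_mul]
        refine integral_congr_ae (.of_forall fun y => ?_)
        simp only; ring
    _ = _ := this
    _ = _ := by
        refine integral_congr_ae (.of_forall fun x => ?_)
        simp only [circleConv]
        rw [← integral_const_mul]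
        refine integral_congr_ae (.of_forall fun y => ?_)
        simp only
        rw [← hJ.even (y - x), neg_sub]; ring

/-- The strong maximum principle. With `χ` the indicator of the set where `d > 0`, the hypothesis
gives `J ∗ χ = 0` on the zero set of `d`; by symmetry of the convolution `J ∗ (1 - χ) = 0` off it, so
`J ∗ χ` is the full mass there. As `J ∗ χ` is continuous and the circle is connected, one of the
two sets is empty. -/
theorem forall_eq_zero_or_forall_pos (hJ : IsCircleKernel J) {d : UnitAddCircle → ℝ}
    (hd : Continuous d) (hd0 : ∀ x, 0 ≤ d x) (h : ∀ x, d x = 0 → circleConv J d x = 0) :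
    (∀ x, d x = 0) ∨ ∀ x, 0 < d x := by
  set Z : Set UnitAddCircle := {x | d x = 0} with hZ
  have hZc : IsClosed Z := isClosed_eq hd continuous_const
  set χ : UnitAddCircle → ℝ := Zᶜ.indicator fun _ => 1 with hχdef
  have hχ : MemLp χ ∞ volume := (memLp_const 1).indicator hZc.measurableSet.compl
  have hχ' : MemLp (fun x => 1 - χ x) ∞ volume := (memLp_const 1).sub hχ
  have hχ01 : ∀ x, 0 ≤ χ x := fun x => indicator_nonneg (fun _ _ => zero_le_one) x
  have hχ02 : ∀ x, 0 ≤ 1 - χ x := fun x => by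
    rw [sub_nonneg]; exact indicator_le_self' (fun _ _ => zero_le_one) x
  -- on the zero set, the kernel charges only the zero set
  have hA : ∀ x ∈ Z, circleConv J χ x = 0 := by
    intro x hx
    have h1 := (integral_eq_zero_iff_of_nonneg (fun y => mul_nonneg (hJ.nonneg _) (hd0 y))
      (hJ.integrable_mul (memLp_top_of_continuous hd) x)).1 (h x hx)
    refine integral_eq_zero_of_ae ?_
    filter_upwards [h1] with y hy
    rcases mul_eq_zero.1 hy with h2 | h2
    · simp [h2]
    · have : y ∉ Zᶜ := fun hy' => hy' h2
      simp [hχdef, this]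
  have hB0 : ∫ x, χ x * circleConv J (fun y => 1 - χ y) x = 0 := by
    rw [hJ.integral_mul_conv_comm hχ' hχ]
    refine integral_eq_zero_of_ae (.of_forall fun x => ?_)
    by_cases hx : x ∈ Z
    · simp [hA x hx]
    · have : x ∈ Zᶜ := hx
      simp [hχdef, this]
  have hcont := hJ.continuous_conv hχ'
  have hnn : ∀ x, 0 ≤ circleConv J (fun y => 1 - χ y) x := fun x =>
    integral_nonneg fun y => mul_nonneg (hJ.nonneg _) (hχ02 y)
  have hB : ∀ x ∈ Zᶜ, circleConv J (fun y => 1 - χ y) x = 0 := by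
    have h1 := (integral_eq_zero_iff_of_nonneg (fun y => mul_nonneg (hχ01 y) (hnn y))
      ((integrable_of_memLp_top (memLp_top_of_continuous hcont)).mul_of_top_right hχ)).1 hB0
    refine Measure.eqOn_open_of_ae_eq (μ := volume) (g := fun _ => 0) ?_ hZc.isOpen_compl
      hcont.continuousOn continuousOn_const
    rw [Filter.EventuallyEq, ae_restrict_iff' hZc.measurableSet.compl]
    filter_upwards [h1] with x hx hxZ
    simpa [hχdef, hxZ] using hx
  have hval : ∀ x ∈ Zᶜ, circleConv J χ x = ∫ y, J y := by
    intro x hx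
    have := hB x hx
    rw [hJ.conv_sub (memLp_const 1) hχ, conv_const] at this
    linarith
  have hclopen : IsClopen Z := by
    refine ⟨hZc, ?_⟩
    have : Z = circleConv J χ ⁻¹' Iio (∫ y, J y) := by
      ext x
      constructor
      · intro hx
        simp [hA x hx, hJ.mass_pos]
      · intro hx
        by_contra hx'
        exact (ne_of_lt hx) (hval x hx')
    rw [this]
    exact isOpen_Iio.preimage (hJ.continuous_conv hχ)
  rcases isClopen_iff.1 hclopen with h0 | h1
  · right
    intro x
    refine lt_of_le_of_ne (hd0 x) fun hx => ?_
    have : x ∈ Z := hx.symm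
    simp [h0] at this
  · left
    intro x
    have : x ∈ Z := by simp [h1]
    exact this

end IsCircleKernel

/-- For bounded arguments the nonlocal term splits into a convolution and a multiple of the
identity. -/
theorem rhs_eq {Jinf : ℝ → ℝ} (hJ : IsKernel Jinf) (f : ℝ → ℝ) (ε : ℝ) {φ : UnitAddCircle → ℝ}
    (hφ : MemLp φ ∞ volume) (x : UnitAddCircle) :
    rhs Jinf f ε φ x =
      ε * (circleConv (periodicKernel Jinf) φ x - (∫ y, periodicKernel Jinf y) * φ x) +
        f (φ x) := by
  have hK := hJ.isCircleKernel
  rw [rhs, ← IsCircleKernel.conv_const (φ x) x, ← hK.conv_sub hφ (memLp_const _)]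
  rfl

/-! ### Regularity of stationary solutions and persistence of the jump -/

namespace IsOddBistable

variable {f : ℝ → ℝ}

theorem differentiable (hf : IsOddBistable f) : Differentiable ℝ f :=
  hf.contDiff.differentiable one_ne_zero

theorem map_zero (hf : IsOddBistable f) : f 0 = 0 := by
  have := hf.odd 0
  rw [neg_zero] at this
  linarith

theorem sub_le (hf : IsOddBistable f) {v w : ℝ} (h : v ≤ w) :
    f w - f v ≤ deriv f 0 * (w - v) :=
  image_sub_le_mul_sub_of_deriv_le hf.differentiable hf.deriv_le h

/-- Above the threshold `a = f' 0` the function `a * v - f v` is a homeomorphism of the line. -/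
theorem exists_continuous_leftInverse (hf : IsOddBistable f) {a : ℝ} (ha : deriv f 0 < a) :
    ∃ k : ℝ → ℝ, Continuous k ∧ ∀ v, k (a * v - f v) = v := by
  set g : ℝ → ℝ := fun v => a * v - f v with hg
  have hinc : ∀ v w, v ≤ w → (a - deriv f 0) * (w - v) ≤ g w - g v := by
    intro v w h
    have := hf.sub_le h
    simp only [hg]
    linarith
  have hmono : StrictMono g := by
    intro v w h
    have h1 := hinc v w h.le
    have : 0 < (a - deriv f 0) * (w - v) := mul_pos (by linarith) (by linarith)
    linarith
  have hcont : Continuous g := by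
    have := hf.differentiable.continuous
    fun_prop
  have h0 : g 0 = 0 := by simp [hg, hf.map_zero]
  have hpos : 0 < a - deriv f 0 := by linarith
  have htop : Tendsto g atTop atTop := by
    refine tendsto_atTop_mono' _ ?_ (tendsto_id.const_mul_atTop hpos)
    filter_upwards [eventually_ge_atTop 0] with v hv
    have := hinc 0 v hv
    simpa [h0] using this
  have hbot : Tendsto g atBot atBot := by
    refine tendsto_atBot_mono' _ ?_ (tendsto_id.const_mul_atBot hpos)
    filter_upwards [eventually_le_atBot 0] with v hv
    have := hinc v 0 hv
    simp only [h0, id] at *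
    linarith
  let e := hmono.orderIsoOfSurjective g (hcont.surjective htop hbot)
  exact ⟨e.symm, e.symm.continuous, fun v => e.symm_apply_apply v⟩

end IsOddBistable

section Stationary

variable {Jinf f : ℝ → ℝ} {ε : ℝ}

/-- Above the threshold, `u x` is a continuous function of `ε * (J ∗ u) x` for every bounded `u` and
every point `x` at which the right-hand side vanishes. -/
theorem exists_continuous_apply_eq (hJ : IsKernel Jinf) (hf : IsOddBistable f)
    (hε : deriv f 0 < ε * ∫ y, periodicKernel Jinf y) :
    ∃ k : ℝ → ℝ, Continuous k ∧ ∀ φ : UnitAddCircle → ℝ, MemLp φ ∞ volume → ∀ x,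
      rhs Jinf f ε φ x = 0 → φ x = k (ε * circleConv (periodicKernel Jinf) φ x) := by
  obtain ⟨k, hk, hkf⟩ := hf.exists_continuous_leftInverse hε
  refine ⟨k, hk, fun φ hφ x hx => ?_⟩
  rw [rhs_eq hJ f ε hφ] at hx
  rw [← hkf (φ x)]
  congr 1
  linarith

/-- Above the threshold, every stationary solution has a continuous representative, which is a
stationary solution at every point. -/
theorem IsStationary.exists_continuousMap (hJ : IsKernel Jinf) (hf : IsOddBistable f)
    (hε : deriv f 0 < ε * ∫ y, periodicKernel Jinf y) {u : State}
    (hu : IsStationary Jinf f ε u) :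
    ∃ v : C(UnitAddCircle, ℝ), u =ᵐ[volume] v ∧ ∀ x, rhs Jinf f ε v x = 0 := by
  obtain ⟨k, hk, hk'⟩ := exists_continuous_apply_eq hJ hf hε
  have hu' := Lp.memLp u
  have hc := hJ.isCircleKernel.continuous_conv hu'
  let v : C(UnitAddCircle, ℝ) := ⟨fun x => k (ε * circleConv (periodicKernel Jinf) u x),
    by fun_prop⟩
  have huv : u =ᵐ[volume] v := by
    filter_upwards [hu] with x hx
    exact hk' u hu' x hx
  have hv := memLp_top_of_continuous v.continuous
  refine ⟨v, huv, ?_⟩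
  have h1 : (fun x => rhs Jinf f ε v x) =ᵐ[volume] fun _ => 0 := by
    filter_upwards [hu, huv] with x hx hxv
    rw [rhs_eq hJ f ε hu'] at hx
    rw [rhs_eq hJ f ε hv, ← IsCircleKernel.conv_congr huv, ← hxv, hx]
  refine congr_fun ((Continuous.ae_eq_iff_eq volume ?_ continuous_const).1 h1)
  rw [show rhs Jinf f ε v = _ from funext (rhs_eq hJ f ε hv)]
  have := hJ.isCircleKernel.continuous_conv hv
  have := hf.differentiable.continuous
  fun_prop

/-- Above the threshold, a bounded pointwise stationary solution is continuous. -/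
theorem continuous_of_forall_rhs_eq_zero (hJ : IsKernel Jinf) (hf : IsOddBistable f)
    (hε : deriv f 0 < ε * ∫ y, periodicKernel Jinf y) {φ : UnitAddCircle → ℝ}
    (hφ : MemLp φ ∞ volume) (h : ∀ x, rhs Jinf f ε φ x = 0) : Continuous φ := by
  obtain ⟨k, hk, hk'⟩ := exists_continuous_apply_eq hJ hf hε
  have hc := hJ.isCircleKernel.continuous_conv hφ
  rw [show φ = fun x => k (ε * circleConv (periodicKernel Jinf) φ x) from
    funext fun x => hk' φ hφ x (h x)]
  fun_prop

end Stationary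

theorem ae_comp_neg {P : UnitAddCircle → Prop} (h : ∀ᵐ x, P x) : ∀ᵐ x, P (-x) :=
  (Measure.measurePreserving_neg (volume : Measure UnitAddCircle)).quasiMeasurePreserving.ae h

/-- Almost everywhere antisymmetry is pointwise for a continuous representative. -/
theorem neg_apply_of_ae_antisymm {u v : UnitAddCircle → ℝ} (hv : Continuous v)
    (huv : ∀ᵐ x, u x = v x) (hodd : ∀ᵐ x, u (-x) = -u x) (x : UnitAddCircle) : v (-x) = -v x := by
  have hneg : ∀ᵐ x, u (-x) = v (-x) := ae_comp_neg (P := fun x => u x = v x) huv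
  have h : ∀ᵐ x, v (-x) = -v x := by
    refine (hneg.and (hodd.and huv)).mono fun y hy => ?_
    obtain ⟨h1, h2, h3⟩ := hy
    have h4 : -u y = -v y := congrArg (fun t : ℝ => -t) h3
    exact (h1.symm.trans h2).trans h4
  have hc1 : Continuous fun x => v (-x) := hv.comp continuous_neg
  exact congr_fun ((Continuous.ae_eq_iff_eq volume hc1 hv.neg).1 h) x

section Jump

variable {Jinf f : ℝ → ℝ} {ε : ℝ}

/-- The filter of points near the interface `0`, up to null sets. -/
noncomputable def nearInterface : Filter UnitAddCircle := 𝓝 0 ⊓ ae volume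

instance : nearInterface.NeBot := by
  rw [nearInterface, inf_neBot_iff]
  intro s hs t ht
  by_contra h
  rw [not_nonempty_iff_eq_empty, ← disjoint_iff_inter_eq_empty] at h
  have : volume s = 0 := measure_mono_null h.subset_compl_right (mem_ae_iff.1 ht)
  exact (Measure.measure_pos_of_mem_nhds volume hs).ne' this

/-- Close to `0`, the nonlinearity grows strictly faster than any slope `a < f' 0`. -/
theorem IsOddBistable.exists_mul_le_map (hf : IsOddBistable f) {a : ℝ} (ha : a < deriv f 0) :
    ∃ ρ > 0, ∃ c > 0, c < 1 ∧ ∀ v ∈ Icc 0 c, (a + ρ) * v ≤ f v := by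
  have hd : HasDerivAt f (deriv f 0) 0 := (hf.differentiable 0).hasDerivAt
  refine ⟨(deriv f 0 - a) / 2, by linarith, ?_⟩
  have h1 := (hasDerivAt_iff_isLittleO.1 hd).def (show 0 < (deriv f 0 - a) / 2 by linarith)
  obtain ⟨δ, hδ, hδ'⟩ := Metric.eventually_nhds_iff.1 h1
  refine ⟨min (δ / 2) (1 / 2), by positivity, (min_le_right _ _).trans_lt (by norm_num), ?_⟩
  intro v hv
  have hvδ : v < δ := (hv.2.trans (min_le_left _ _)).trans_lt (by linarith)
  have := @hδ' v (by rw [Real.dist_eq, sub_zero, abs_of_nonneg hv.1]; exact hvδ)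
  rw [hf.map_zero, sub_zero, sub_zero, smul_eq_mul, Real.norm_eq_abs, Real.norm_eq_abs,
    abs_of_nonneg hv.1, abs_le] at this
  nlinarith [this.1]

/-- Values of a bounded antisymmetric stationary solution near the interface cannot be of
intermediate size. -/
theorem eventually_nearInterface_dichotomy (hJ : IsKernel Jinf) (hf : IsOddBistable f)
    {a ρ c : ℝ} (hρ : 0 < ρ) (hc0 : 0 < c) (hc : ∀ v ∈ Icc 0 c, (a + ρ) * v ≤ f v)
    (hε : ε * ∫ y, periodicKernel Jinf y ≤ a) {u : State}
    (hu : IsStationary Jinf f ε u) (hodd : ∀ᵐ x, u (-x) = -u x) :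
    ∀ᶠ x in nearInterface, |u x| < c / 2 ∨ c < |u x| := by
  have hu' := Lp.memLp u
  have hK := hJ.isCircleKernel
  have hcont := hK.continuous_conv hu'
  have h0 : circleConv (periodicKernel Jinf) u 0 = 0 := by
    have h1 : circleConv (periodicKernel Jinf) (fun y => u (-y)) 0 =
        circleConv (periodicKernel Jinf) (fun y => -u y) 0 := by
      rw [IsCircleKernel.conv_congr hodd]
    rw [hK.conv_neg, neg_zero] at h1
    have h2 : circleConv (periodicKernel Jinf) (fun y => -u y) 0 =
        -circleConv (periodicKernel Jinf) u 0 := by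
      simp only [circleConv, mul_neg, integral_neg]
    linarith
  have hsmall : ∀ᶠ x in 𝓝 (0 : UnitAddCircle),
      |ε * circleConv (periodicKernel Jinf) u x| < ρ * (c / 2) := by
    have : Tendsto (fun x => |ε * circleConv (periodicKernel Jinf) u x|) (𝓝 0) (𝓝 0) := by
      have hc : Continuous fun x => |ε * circleConv (periodicKernel Jinf) u x| := by fun_prop
      simpa [h0] using hc.tendsto 0
    exact this.eventually_lt_const (by positivity)
  have h1 : ∀ᶠ x in nearInterface, rhs Jinf f ε u x = 0 := hu.filter_mono inf_le_right
  filter_upwards [h1, hsmall.filter_mono inf_le_left] with x hx1 hx2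
  by_contra! hcon
  rw [rhs_eq hJ f ε hu'] at hx1
  -- by oddness of `f` it suffices to look at `|u x|`
  have h3 : f |u x| - (ε * ∫ y, periodicKernel Jinf y) * |u x| ≤
      |ε * circleConv (periodicKernel Jinf) u x| := by
    rcases abs_cases (u x) with ⟨h, _⟩ | ⟨h, _⟩
    · rw [h]
      refine le_trans (le_of_eq ?_) (neg_le_abs _)
      linarith
    · rw [h, hf.odd]
      refine le_trans (le_of_eq ?_) (le_abs_self _)
      linarith
  have h4 := hc |u x| ⟨abs_nonneg _, hcon.2⟩
  nlinarith [hcon.1, abs_nonneg (u x)]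

/-- Below the threshold, the jump at the interface present at `ε = 0` persists: the property that
`|u ε| > c` near the interface is open and closed in `ε` by the dichotomy. -/
theorem IsZeroMeanOneInterfaceBranch.exists_jump (hJ : IsKernel Jinf) (hf : IsOddBistable f)
    {I : Set ℝ} {u : ℝ → State} (hu : IsZeroMeanOneInterfaceBranch Jinf f I u) (hεI : ε ∈ I)
    (hε : ε * ∫ y, periodicKernel Jinf y < deriv f 0) : ∃ c > 0, ∀ᶠ x in nearInterface, c < |u ε x| := by
  have hm := hJ.isCircleKernel.mass_pos
  obtain ⟨ρ, hρ, c, hc0, hc1, hc⟩ := hf.exists_mul_le_map hε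
  have hsub : Icc 0 ε ⊆ I := hu.ordConnected.out hu.zero_mem hεI
  have hdich : ∀ e ∈ Icc 0 ε, ∀ᶠ x in nearInterface, |u e x| < c / 2 ∨ c < |u e x| := fun e he =>
    eventually_nearInterface_dichotomy hJ hf hρ hc0 hc
      (mul_le_mul_of_nonneg_right he.2 hm.le) (hu.stationary e (hsub he)) (hu.antisymm e (hsub he))
  let Q : ℝ → Prop := fun e => ∀ᶠ x in nearInterface, c < |u e x|
  have hQ : ∀ e ∈ Icc 0 ε, ∀ e' ∈ Icc 0 ε, dist (u e') (u e) < c / 2 → Q e → Q e' := by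
    intro e he e' he' hd hQe
    have h1 : ∀ᶠ x in nearInterface, |u e' x - u e x| ≤ dist (u e') (u e) := by
      refine Filter.Eventually.filter_mono inf_le_right ?_
      rw [dist_eq_norm]
      exact State.ae_abs_sub_le_norm (u e') (u e)
    filter_upwards [h1, hQe, hdich e' he'] with x hx1 hx2 hx3
    refine hx3.resolve_left fun hx4 => ?_
    have := abs_sub_abs_le_abs_sub (u e x) (u e' x)
    rw [abs_sub_comm] at this
    linarith
  have hloc : IsLocallyConstant fun e : Icc 0 ε => Q e := by
    rw [IsLocallyConstant.iff_eventually_eq]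
    intro e
    have hcont : Continuous fun e : Icc 0 ε => u e :=
      continuousOn_iff_continuous_domRestrict.1 (hu.continuousOn.mono hsub)
    filter_upwards [Metric.tendsto_nhds.1 (hcont.tendsto e) (c / 2) (by positivity)] with e' he'
    exact propext ⟨hQ e' e'.2 e e.2 (by rwa [dist_comm]), hQ e e.2 e' e'.2 he'⟩
  have hε0 := hu.nonneg ε hεI
  have hpre : PreconnectedSpace (Icc 0 ε) := Subtype.preconnectedSpace isPreconnected_Icc
  have hQ0 : Q 0 := by
    refine Filter.Eventually.filter_mono inf_le_right ?_
    filter_upwards [hu.start] with x hx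
    rw [hx, stepProfile]
    split_ifs <;> simpa using hc1
  have := hloc.apply_eq_of_preconnectedSpace ⟨0, left_mem_Icc.2 hε0⟩ ⟨ε, right_mem_Icc.2 hε0⟩
  exact ⟨c, hc0, this.mp hQ0⟩

/-- Below the threshold the branch is discontinuous, because a continuous antisymmetric function
vanishes at `0`. -/
theorem IsZeroMeanOneInterfaceBranch.isDiscontinuous (hJ : IsKernel Jinf) (hf : IsOddBistable f)
    {I : Set ℝ} {u : ℝ → State} (hu : IsZeroMeanOneInterfaceBranch Jinf f I u) (hεI : ε ∈ I)
    (hε : ε * ∫ y, periodicKernel Jinf y < deriv f 0) : IsDiscontinuous (u ε) := by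
  obtain ⟨c, hc0, hQε⟩ := hu.exists_jump hJ hf hεI hε
  rintro ⟨v, hv, huv⟩
  have hv0 : v 0 = 0 := by
    have := neg_apply_of_ae_antisymm hv huv (hu.antisymm ε hεI) 0
    rw [neg_zero] at this
    linarith
  have hv1 : ∀ᶠ x in nearInterface, |v x| < c := by
    refine Filter.Eventually.filter_mono inf_le_left ?_
    have : Tendsto (fun x => |v x|) (𝓝 0) (𝓝 0) := by
      simpa [hv0] using hv.abs.tendsto 0
    exact this.eventually_lt_const hc0
  have huv' : ∀ᶠ x in nearInterface, u ε x = v x := huv.filter_mono inf_le_right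
  obtain ⟨x, hx1, hx2, hx3⟩ := (hv1.and (huv'.and hQε)).exists
  rw [hx2] at hx3
  exact lt_asymm hx1 hx3

end Jump

/-! ### Stability of the one-interface profile at `ε = 0` -/

section StableAtZero

variable {Jinf f : ℝ → ℝ}

/-- Short Euler steps of `v' = f v` do not increase the distance to the stable zeros `1`, `-1`. -/
theorem IsOddBistable.exists_euler_contraction (hf : IsOddBistable f) :
    ∃ r > 0, ∃ h₀ > 0, ∀ s : ℝ, s = 1 ∨ s = -1 → ∀ v, |v - s| ≤ r → ∀ h ∈ Icc 0 h₀,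
      |v - s + h * f v| ≤ |v - s| := by
  have hone : ∃ r > 0, ∃ h₀ > 0, ∀ v, |v - 1| ≤ r → ∀ h ∈ Icc 0 h₀,
      |v - 1 + h * f v| ≤ |v - 1| := by
    obtain ⟨k, hk⟩ : ∃ k, deriv f 1 = -k := ⟨-deriv f 1, by ring⟩
    have hk0 : 0 < k := by linarith [hf.deriv_one_neg]
    have hd : HasDerivAt f (-k) 1 := hk ▸ (hf.differentiable 1).hasDerivAt
    have h1 := (hasDerivAt_iff_isLittleO.1 hd).def (show 0 < k / 2 by linarith)
    obtain ⟨δ, hδ, hδ'⟩ := Metric.eventually_nhds_iff.1 h1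
    refine ⟨δ / 2, by positivity, 1 / (2 * k), by positivity, fun v hv h hh => ?_⟩
    have h2 := @hδ' v (by rw [Real.dist_eq]; linarith)
    rw [hf.map_one, sub_zero, smul_eq_mul, Real.norm_eq_abs, Real.norm_eq_abs] at h2
    have h3 : h * k ≤ 1 / 2 := by
      have := mul_le_mul_of_nonneg_right hh.2 hk0.le
      calc h * k ≤ 1 / (2 * k) * k := this
        _ = 1 / 2 := by field_simp
    have h4 : v - 1 + h * f v = (1 - h * k) * (v - 1) + h * (f v - (v - 1) * -k) := by ring
    rw [h4]
    refine (abs_add_le _ _).trans ?_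
    rw [abs_mul, abs_mul, abs_of_nonneg hh.1, abs_of_nonneg (by linarith : 0 ≤ 1 - h * k)]
    have h5 := mul_le_mul_of_nonneg_left h2 hh.1
    have h6 := mul_nonneg (mul_nonneg hh.1 hk0.le) (abs_nonneg (v - 1))
    linarith
  obtain ⟨r, hr, h₀, hh₀, H⟩ := hone
  refine ⟨r, hr, h₀, hh₀, ?_⟩
  rintro s (rfl | rfl) v hv h hh
  · exact H v hv h hh
  · have e1 : |v - -1| = |-v - 1| := by rw [← abs_neg]; congr 1; ring
    have e2 : |v - -1 + h * f v| = |-v - 1 + h * f (-v)| := by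
      rw [hf.odd, ← abs_neg]; congr 1; ring
    rw [e1] at hv ⊢
    rw [e2]
    exact H (-v) hv h hh

/-- Without diffusion the one-interface profile is stable. Null sets depend on time, so the distance
`‖w t - u‖` is estimated in `L^∞` rather than pointwise: its right lower derivative is at most `0`
as long as the distance itself is small. -/
theorem isStable_zero (hf : IsOddBistable f) {u : State} (hu : ∀ᵐ x, u x = stepProfile x) :
    IsStable Jinf f 0 u := by
  obtain ⟨r, hr, h₀, hh₀, H⟩ := hf.exists_euler_contraction
  intro η hη
  have hη' : 0 < min η r := lt_min hη hr
  refine ⟨min η r / 2, by positivity, fun T hT w hw hw0 => ?_⟩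
  choose! w' hw' hrhs using hw
  have hnear : ∀ t ∈ Ico 0 T, ‖w t - u‖ ≤ r → ∀ ρ > 0,
      ∃ᶠ z in 𝓝[>] t, slope (fun t => ‖w t - u‖) t z < ρ := by
    intro t ht htr ρ hρ
    refine Eventually.frequently ?_
    have h1 := (hasDerivWithinAt_iff_isLittleO.1 (hw' t ht)).def (half_pos hρ)
    have h2 : ∀ᶠ z in 𝓝[>] t, ‖w z - w t - (z - t) • w' t‖ ≤ ρ / 2 * ‖z - t‖ :=
      h1.filter_mono (nhdsWithin_mono _ fun s hs => ht.1.trans (le_of_lt hs))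
    have h3 : ∀ᶠ z in 𝓝[>] t, z ∈ Ioo t (t + h₀) := Ioo_mem_nhdsGT (by linarith)
    filter_upwards [h2, h3] with z hz hz'
    have hzt : 0 < z - t := by linarith [hz'.1]
    have h4 : ‖w t + (z - t) • w' t - u‖ ≤ ‖w t - u‖ := by
      refine State.norm_sub_le _ _ (norm_nonneg _) ?_
      filter_upwards [Lp.coeFn_add (w t) ((z - t) • w' t), Lp.coeFn_smul (z - t) (w' t),
        hrhs t ht, hu, State.ae_abs_sub_le_norm (w t) u] with x h1 h2 h3 h4 h5
      rw [h1, Pi.add_apply, h2, Pi.smul_apply, h3, smul_eq_mul, rhs, zero_mul, zero_add]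
      have h6 := H (u x) (by rw [h4, stepProfile]; split_ifs <;> simp) (w t x) (h5.trans htr)
        (z - t) ⟨hzt.le, by linarith [hz'.2]⟩
      refine le_trans (le_of_eq ?_) (h6.trans h5)
      congr 1; ring
    have h5 : ‖w z - u‖ ≤ ‖w t - u‖ + ρ / 2 * (z - t) := by
      calc ‖w z - u‖ = ‖(w t + (z - t) • w' t - u) + (w z - w t - (z - t) • w' t)‖ := by
            congr 1; abel
        _ ≤ _ := (norm_add_le _ _).trans (add_le_add h4 (by
            rwa [Real.norm_of_nonneg hzt.le] at hz))
    rw [slope_def_field, div_lt_iff₀ hzt]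
    nlinarith
  have hfar : ∀ t ∈ Ico 0 T, ∀ ρ, ‖w' t‖ < ρ →
      ∃ᶠ z in 𝓝[>] t, slope (fun t => ‖w t - u‖) t z < ρ := by
    intro t ht ρ hρ
    refine ((((hw' t ht).mono (Ici_subset_Ici.2 ht.1)).sub_const u).liminf_right_slope_norm_le
      hρ).mono fun z hz => ?_
    rwa [slope_def_field, div_eq_inv_mul]
  intro t ht
  classical
  -- the slowly growing barrier `B` stays below `r` on `[0, T)`, so the crude bound by `‖w'‖`
  -- is never needed where the distance touches it
  have key := image_le_of_liminf_slope_right_lt_deriv_boundary'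
    (f := fun t => ‖w t - u‖) (f' := fun t => if ‖w t - u‖ ≤ r then 0 else ‖w' t‖)
    (a := 0) (b := t) (B := fun s => min η r / 2 * (1 + s / T)) (B' := fun _ => min η r / 2 / T)
    ?_ ?_ ?_ ?_ ?_ ?_
  · have h1 := key (right_mem_Icc.2 ht.1)
    have h2 : t / T < 1 := (div_lt_one hT).2 ht.2
    have h3 : min η r ≤ η := min_le_left _ _
    have h4 : min η r / 2 * (1 + t / T) < min η r := by nlinarith
    exact (h1.trans_lt h4).trans_le h3
  · intro s hs
    have hs' : s ∈ Ico 0 T := ⟨hs.1, hs.2.trans_lt ht.2⟩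
    exact ((hw' s hs').continuousWithinAt.mono fun _ h => h.1).sub continuousWithinAt_const |>.norm
  · intro s hs ρ hρ
    have hs' : s ∈ Ico 0 T := ⟨hs.1, hs.2.trans ht.2⟩
    split_ifs at hρ with h
    · exact hnear s hs' h ρ hρ
    · exact hfar s hs' ρ hρ
  · simpa using hw0.le
  · fun_prop
  · intro s hs
    have : HasDerivAt (fun s => min η r / 2 * (1 + s / T)) (min η r / 2 * (1 / T)) s :=
      (((hasDerivAt_id s).div_const T).const_add 1).const_mul _
    rw [mul_one_div] at this
    exact this.hasDerivWithinAt
  · intro s hs hs'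
    have h2 : s / T ≤ 1 := (div_le_one hT).2 (hs.2.trans ht.2).le
    have h3 : min η r ≤ r := min_le_right _ _
    have : ‖w s - u‖ ≤ r := by
      rw [hs']
      nlinarith
    rw [if_pos this]
    positivity

end StableAtZero

/-! ### Global solutions and comparison in spaces of continuous functions -/

section Flow

/-- A bounded, globally Lipschitz vector field has global forward solutions. -/
theorem exists_global_solution {E : Type*} [NormedAddCommGroup E] [NormedSpace ℝ E]
    [CompleteSpace E] {G : E → E} {C L : NNReal} (hG : LipschitzWith C G) (hL : ∀ φ, ‖G φ‖ ≤ L)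
    (φ₀ : E) :
    ∃ w : ℝ → E, w 0 = φ₀ ∧ ∀ t, 0 ≤ t → HasDerivWithinAt w (G (w t)) (Ici 0) t := by
  have hloc : ∀ n : ℕ, ∃ α : ℝ → E, α 0 = φ₀ ∧
      ∀ t ∈ Icc (0 : ℝ) n, HasDerivWithinAt α (G (α t)) (Icc 0 n) t := by
    intro n
    have hP : IsPicardLindelof (fun _ => G) (⟨0, by simp⟩ : Icc (0 : ℝ) n) φ₀ (L * n) 0 L C :=
      { lipschitzOnWith := fun _ _ => hG.lipschitzOnWith
        continuousOn := fun _ _ => continuousOn_const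
        norm_le := fun _ _ φ _ => hL φ
        mul_max_le := by simp }
    exact hP.exists_eq_forall_mem_Icc_hasDerivWithinAt₀
  choose α hα0 hα using hloc
  have hright : ∀ (n : ℕ) (t : ℝ), 0 ≤ t → t < n →
      HasDerivWithinAt (α n) (G (α n t)) (Ici t) t := by
    intro n t h0 hn
    exact (hα n t ⟨h0, hn.le⟩).mono_of_mem_nhdsWithin
      (mem_of_superset (Icc_mem_nhdsGE hn) (Icc_subset_Icc_left h0))
  have hagree : ∀ (m n : ℕ) (t : ℝ), 0 ≤ t → t < m → t < n → α m t = α n t := by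
    intro m n t h0 hm hn
    refine ODE_solution_unique (v := fun _ => G) (K := C) (a := 0) (b := t) (fun _ => hG)
      (fun s hs => ((hα m s ⟨hs.1, hs.2.trans hm.le⟩).continuousWithinAt.mono
        (Icc_subset_Icc_right hm.le)))
      (fun s hs => hright m s hs.1 (hs.2.trans hm))
      (fun s hs => ((hα n s ⟨hs.1, hs.2.trans hn.le⟩).continuousWithinAt.mono
        (Icc_subset_Icc_right hn.le)))
      (fun s hs => hright n s hs.1 (hs.2.trans hn))
      (by rw [hα0, hα0]) (right_mem_Icc.2 h0)
  have hfloor : ∀ t : ℝ, t < ((⌊t⌋₊ + 1 : ℕ) : ℝ) := fun t => by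
    push_cast; exact Nat.lt_floor_add_one t
  refine ⟨fun t => α (⌊t⌋₊ + 1) t, hα0 _, fun t ht => ?_⟩
  set n := ⌊t⌋₊ + 1 with hn
  have htn : t < n := hfloor t
  have h1 : HasDerivWithinAt (α n) (G (α n t)) (Ici 0) t :=
    (hα n t ⟨ht, htn.le⟩).mono_of_mem_nhdsWithin
      (inter_mem_nhdsWithin (Ici 0) (Iic_mem_nhds htn))
  refine h1.congr_of_eventuallyEq ?_ (by simp [hn])
  filter_upwards [self_mem_nhdsWithin, mem_nhdsWithin_of_mem_nhds (Iio_mem_nhds htn)] with s hs hs'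
  exact hagree _ _ s hs (hfloor s) hs'

variable {X : Type*} [TopologicalSpace X] [CompactSpace X]

/-- Comparison principle for a Lipschitz vector field `G` on `C(X, ℝ)` such that `K + G` is monotone:
the norm of the positive part of `a - b` satisfies a Grönwall inequality. -/
theorem le_of_subsolution_of_supersolution {G : C(X, ℝ) → C(X, ℝ)} {C : NNReal}
    (hG : LipschitzWith C G) {K : ℝ} (hK : 0 ≤ K)
    (hmono : ∀ φ ψ : C(X, ℝ), φ ≤ ψ → ∀ x, K * φ x + G φ x ≤ K * ψ x + G ψ x)
    {a b a' b' : ℝ → C(X, ℝ)} {T : ℝ} (hac : ContinuousOn a (Icc 0 T))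
    (hbc : ContinuousOn b (Icc 0 T))
    (ha : ∀ t ∈ Ico 0 T, HasDerivWithinAt a (a' t) (Ici t) t)
    (hb : ∀ t ∈ Ico 0 T, HasDerivWithinAt b (b' t) (Ici t) t)
    (ha' : ∀ t ∈ Ico 0 T, a' t ≤ G (a t)) (hb' : ∀ t ∈ Ico 0 T, G (b t) ≤ b' t)
    (h0 : a 0 ≤ b 0) : ∀ t ∈ Icc 0 T, a t ≤ b t := by
  -- the positive part of the difference
  set p : ℝ → C(X, ℝ) := fun t => (a t - b t) ⊔ 0 with hp
  have hpapp : ∀ t x, p t x = max (a t x - b t x) 0 := fun t x => rfl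
  have hple : ∀ t x, p t x ≤ ‖p t‖ := fun t x =>
    (le_abs_self _).trans ((p t).norm_coe_le_norm x)
  have hpc : ContinuousOn (fun t => ‖p t‖) (Icc 0 T) :=
    ((ContinuousMap.continuous_postcomp (⟨fun v => max v 0, by fun_prop⟩ : C(ℝ, ℝ))).comp_continuousOn
      (hac.sub hbc)).norm
  have hslope : ∀ t ∈ Ico 0 T, ∀ r, C * ‖p t‖ < r →
      ∃ᶠ z in 𝓝[>] t, (z - t)⁻¹ * (‖p z‖ - ‖p t‖) < r := by
    intro t ht r hr
    refine Eventually.frequently ?_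
    set ρ := (r - C * ‖p t‖) / 2 with hρ
    have hρ0 : 0 < ρ := by rw [hρ]; linarith
    have h1 := (hasDerivWithinAt_iff_isLittleO.1 ((ha t ht).sub (hb t ht))).def hρ0
    have h2 := h1.filter_mono (nhdsWithin_mono t Ioi_subset_Ici_self)
    have h3 : ∀ᶠ z in 𝓝[>] t, z ∈ Ioo t (t + 1 / (K + 1)) :=
      Ioo_mem_nhdsGT (by have : 0 < 1 / (K + 1) := by positivity
                         linarith)
    filter_upwards [h2, h3] with z hz hz'
    have hzt : 0 < z - t := by linarith [hz'.1]
    have hKz : (z - t) * K ≤ 1 := by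
      have h4 : z - t ≤ 1 / (K + 1) := by linarith [hz'.2]
      rw [le_div_iff₀ (by linarith)] at h4
      nlinarith
    have hbound : ‖p z‖ ≤ ‖p t‖ + (z - t) * (C * ‖p t‖ + ρ) := by
      have hnn : 0 ≤ ‖p t‖ + (z - t) * (C * ‖p t‖ + ρ) := by positivity
      rw [ContinuousMap.norm_le _ hnn]
      intro x
      rw [hpapp, Real.norm_of_nonneg (le_max_right _ _), max_le_iff]
      refine ⟨?_, hnn⟩
      rw [Real.norm_of_nonneg hzt.le] at hz
      have hrem := (le_abs_self _).trans ((ContinuousMap.norm_coe_le_norm _ x).trans hz)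
      simp only [ContinuousMap.sub_apply, ContinuousMap.smul_apply, smul_eq_mul, Pi.sub_apply]
        at hrem
      have hda : a' t x ≤ G (a t) x := ha' t ht x
      have hdb : G (b t) x ≤ b' t x := hb' t ht x
      -- monotonicity of `K + G` is applied to `a t ≤ b t + p t`
      have hcmp : a t ≤ b t + p t := fun y => by
        change a t y ≤ b t y + max (a t y - b t y) 0
        linarith [le_max_left (a t y - b t y) 0]
      have hm := hmono _ _ hcmp x
      have hlip : G (b t + p t) x - G (b t) x ≤ C * ‖p t‖ := by
        have := hG.dist_le_mul (b t + p t) (b t)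
        rw [dist_eq_norm, dist_eq_norm, add_sub_cancel_left] at this
        exact (le_abs_self _).trans (((G (b t + p t) - G (b t)).norm_coe_le_norm x).trans this)
      rw [ContinuousMap.add_apply] at hm
      have hpx := hple t x
      have hdx : a t x - b t x ≤ p t x := le_max_left _ _
      have e1 : (z - t) * (a' t x - b' t x) ≤
          (z - t) * (K * (b t x + p t x - a t x) + C * ‖p t‖) :=
        mul_le_mul_of_nonneg_left (by linarith) hzt.le
      have e2 : 0 ≤ (1 - (z - t) * K) * (p t x - (a t x - b t x)) :=
        mul_nonneg (by linarith) (by linarith)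
      nlinarith
    rw [inv_mul_lt_iff₀ hzt]
    have : (z - t) * (C * ‖p t‖ + ρ) < (z - t) * r := by
      refine mul_lt_mul_of_pos_left ?_ hzt
      rw [hρ]; linarith
    linarith
  intro t ht
  have hp0 : ‖p 0‖ ≤ 0 := by
    rw [ContinuousMap.norm_le _ le_rfl]
    intro x
    have : a 0 x - b 0 x ≤ 0 := sub_nonpos.2 (h0 x)
    rw [hpapp, max_eq_right this, norm_zero]
  have hg := le_gronwallBound_of_liminf_deriv_right_le (f := fun t => ‖p t‖)
    (f' := fun t => C * ‖p t‖) (δ := 0) (K := C) (ε := 0) hpc hslope hp0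
    (fun x _ => by simp) t ht
  rw [gronwallBound_ε0_δ0] at hg
  intro x
  change a t x ≤ b t x
  have h5 := (hple t x).trans hg
  rw [hpapp] at h5
  linarith [le_max_left (a t x - b t x) 0]

/-- A solution starting from a stationary subsolution is nondecreasing in time. -/
theorem monotoneOn_of_subsolution {G : C(X, ℝ) → C(X, ℝ)} {C : NNReal}
    (hG : LipschitzWith C G) {K : ℝ} (hK : 0 ≤ K)
    (hmono : ∀ φ ψ : C(X, ℝ), φ ≤ ψ → ∀ x, K * φ x + G φ x ≤ K * ψ x + G ψ x)
    {w : ℝ → C(X, ℝ)} (hw : ∀ t, 0 ≤ t → HasDerivWithinAt w (G (w t)) (Ici 0) t)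
    (h0 : 0 ≤ G (w 0)) : MonotoneOn w (Ici 0) := by
  have hcont : ContinuousOn w (Ici 0) := fun t ht => (hw t ht).continuousWithinAt
  have hright : ∀ t, 0 ≤ t → HasDerivWithinAt w (G (w t)) (Ici t) t := fun t ht =>
    (hw t ht).mono (Ici_subset_Ici.2 ht)
  have h1 : ∀ t, 0 ≤ t → w 0 ≤ w t := by
    intro t ht
    refine le_of_subsolution_of_supersolution hG hK hmono (a := fun _ => w 0) (b := w)
      (a' := fun _ => 0) (b' := fun t => G (w t)) (T := t) continuousOn_const
      (hcont.mono Icc_subset_Ici_self) (fun s _ => hasDerivWithinAt_const _ _ _)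
      (fun s hs => hright s hs.1) (fun _ _ => h0) (fun _ _ => le_rfl) le_rfl t
      (right_mem_Icc.2 ht)
  intro s hs t ht hst
  have hs0 : (0 : ℝ) ≤ s := hs
  have hh : 0 ≤ t - s := sub_nonneg.2 hst
  have := le_of_subsolution_of_supersolution hG hK hmono (a := w) (b := fun r => w (r + (t - s)))
      (a' := fun t => G (w t)) (b' := fun r => G (w (r + (t - s)))) (T := s)
      (hcont.mono Icc_subset_Ici_self)
      (hcont.comp (by fun_prop) fun r hr => add_nonneg hr.1 hh)
      (fun r hr => hright r hr.1) (fun r hr => ?_) (fun _ _ => le_rfl) (fun _ _ => le_rfl)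
      (by simpa using h1 (t - s) hh) s (right_mem_Icc.2 hs0)
  · simpa using this
  · have h2 := hright (r + (t - s)) (add_nonneg hr.1 hh)
    have h3 : HasDerivWithinAt (fun r => r + (t - s)) 1 (Ici r) r :=
      ((hasDerivAt_id r).add_const _).hasDerivWithinAt
    have := h2.scomp r h3 (fun y hy => by
      simp only [mem_Ici] at hy ⊢; linarith)
    simpa using! this

end Flow

/-! ### Stationary solutions near a stable one -/

section Truncation

/-- Truncation of a real number to `[-R, R]`. -/
noncomputable def clip (R v : ℝ) : ℝ := max (-R) (min v R)

theorem continuous_clip (R : ℝ) : Continuous (clip R) := by unfold clip; fun_prop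

theorem clip_mem {R : ℝ} (hR : 0 ≤ R) (v : ℝ) : clip R v ∈ Icc (-R) R :=
  ⟨le_max_left _ _, max_le (by linarith) (min_le_right _ _)⟩

theorem abs_clip_le {R : ℝ} (hR : 0 ≤ R) (v : ℝ) : |clip R v| ≤ R := abs_le.2 (clip_mem hR v)

theorem clip_mono (R : ℝ) : Monotone (clip R) := fun _ _ h =>
  max_le_max le_rfl (min_le_min h le_rfl)

theorem clip_of_abs_le {R v : ℝ} (h : |v| ≤ R) : clip R v = v := by
  rw [abs_le] at h
  rw [clip, min_eq_left h.2, max_eq_right h.1]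

theorem abs_clip_sub_le (R v w : ℝ) : |clip R v - clip R w| ≤ |v - w| := by
  rw [clip, clip, max_comm, max_comm (-R)]
  exact (abs_max_sub_max_le_abs _ _ _).trans (by
    rw [min_comm, min_comm w]
    have := abs_min_sub_min_le_max R v R w
    simpa using this)

variable {Jinf f : ℝ → ℝ} {ε : ℝ}

theorem continuous_rhs (hJ : IsKernel Jinf) (hf : IsOddBistable f) {φ : UnitAddCircle → ℝ}
    (hφ : Continuous φ) : Continuous (rhs Jinf f ε φ) := by
  have hm := memLp_top_of_continuous hφ
  rw [show rhs Jinf f ε φ = _ from funext (rhs_eq hJ f ε hm)]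
  have := hJ.isCircleKernel.continuous_conv hm
  have := hf.differentiable.continuous
  fun_prop

/-- The right-hand side with its argument truncated is a bounded and Lipschitz vector field on the
continuous functions, and becomes monotone after adding a multiple of the identity. -/
theorem exists_truncated_field (hJ : IsKernel Jinf) (hf : IsOddBistable f) (hε : 0 ≤ ε)
    {R : ℝ} (hR : 0 ≤ R) :
    ∃ G : C(UnitAddCircle, ℝ) → C(UnitAddCircle, ℝ), ∃ C L : NNReal, ∃ K : ℝ,
      (∀ φ x, G φ x = rhs Jinf f ε (fun y => clip R (φ y)) x) ∧ LipschitzWith C G ∧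
      (∀ φ, ‖G φ‖ ≤ L) ∧ 0 ≤ K ∧
      ∀ φ ψ : C(UnitAddCircle, ℝ), φ ≤ ψ → ∀ x, K * φ x + G φ x ≤ K * ψ x + G ψ x := by
  have hK := hJ.isCircleKernel
  set J := periodicKernel Jinf with hJdef
  set m := ∫ y, J y with hm
  have hm0 : 0 ≤ m := hK.mass_pos.le
  have hεm : 0 ≤ ε * m := mul_nonneg hε hm0
  have hcont : ∀ φ : C(UnitAddCircle, ℝ), Continuous fun y => clip R (φ y) := fun φ =>
    (continuous_clip R).comp φ.continuous
  have hmem := fun φ : C(UnitAddCircle, ℝ) => memLp_top_of_continuous (hcont φ)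
  obtain ⟨F, hF⟩ := hf.contDiff.contDiffOn.exists_lipschitzOnWith one_ne_zero
    (convex_Icc (-R) R) isCompact_Icc
  have hF' : ∀ v w, |f (clip R v) - f (clip R w)| ≤ F * |clip R v - clip R w| := fun v w => by
    have := hF.dist_le_mul _ (clip_mem hR v) _ (clip_mem hR w)
    rwa [Real.dist_eq, Real.dist_eq] at this
  let G : C(UnitAddCircle, ℝ) → C(UnitAddCircle, ℝ) := fun φ =>
    ⟨rhs Jinf f ε (fun y => clip R (φ y)), continuous_rhs hJ hf (hcont φ)⟩
  have hG : ∀ φ x, G φ x = ε * (circleConv J (fun y => clip R (φ y)) x - m * clip R (φ x)) +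
      f (clip R (φ x)) := fun φ x => rhs_eq hJ f ε (hmem φ) x
  have hlip : ∀ φ ψ x, |G φ x - G ψ x| ≤ (2 * (ε * m) + F) * ‖φ - ψ‖ := by
    intro φ ψ x
    have hd : ∀ y, |clip R (φ y) - clip R (ψ y)| ≤ ‖φ - ψ‖ := fun y =>
      (abs_clip_sub_le R _ _).trans ((φ - ψ).norm_coe_le_norm y)
    have h1 := hK.abs_conv_sub_le (hmem φ) (hmem ψ) (.of_forall hd) x
    have h2 := hF' (φ x) (ψ x)
    rw [hG, hG]
    have e : ∀ A B a b p q : ℝ, ε * (A - m * a) + p - (ε * (B - m * b) + q) =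
      ε * (A - B) + -(ε * m * (a - b)) + (p - q) := by intros; ring
    rw [e]
    refine (abs_add_three _ _ _).trans ?_
    rw [abs_neg, abs_mul, abs_mul (ε * m), abs_of_nonneg hε, abs_of_nonneg hεm]
    have h3 := mul_le_mul_of_nonneg_left h1 hε
    have h4 := mul_le_mul_of_nonneg_left (hd x) hεm
    have h5 := mul_le_mul_of_nonneg_left (hd x) F.2
    change (F : ℝ) * _ ≤ (F : ℝ) * _ at h5
    nlinarith
  obtain ⟨C, hC⟩ : ∃ C : NNReal, (C : ℝ) = 2 * (ε * m) + F :=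
    ⟨Real.toNNReal _, Real.coe_toNNReal _ (by positivity)⟩
  obtain ⟨L, hL⟩ : ∃ L : NNReal, (L : ℝ) = 2 * (ε * m) * R + F * R :=
    ⟨Real.toNNReal _, Real.coe_toNNReal _ (by positivity)⟩
  refine ⟨G, C, L, ε * m + F, fun φ x => rfl, ?_, ?_, by positivity, ?_⟩
  · refine LipschitzWith.of_dist_le_mul fun φ ψ => ?_
    rw [dist_eq_norm, dist_eq_norm,
      ContinuousMap.norm_le _ (mul_nonneg (NNReal.coe_nonneg _) (norm_nonneg _))]
    exact fun x => by rw [hC]; exact hlip φ ψ x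
  · intro φ
    rw [ContinuousMap.norm_le _ (NNReal.coe_nonneg _)]
    intro x
    have h1 := hK.abs_conv_le (hmem φ) (.of_forall fun y => abs_clip_le hR (φ y)) x
    have h2 := hF' (φ x) 0
    have h3 : clip R 0 = 0 := clip_of_abs_le (by simpa using hR)
    rw [h3, hf.map_zero, sub_zero, sub_zero] at h2
    have h4 := abs_clip_le hR (φ x)
    rw [hG, Real.norm_eq_abs]
    have e : ∀ A a p : ℝ, ε * (A - m * a) + p = ε * A + -(ε * m * a) + p := by intros; ring
    rw [e]
    refine (abs_add_three _ _ _).trans ?_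
    rw [abs_neg, abs_mul, abs_mul (ε * m), abs_of_nonneg hε, abs_of_nonneg hεm]
    have h5 := mul_le_mul_of_nonneg_left h1 hε
    have h6 := mul_le_mul_of_nonneg_left h4 hεm
    have h7 := mul_le_mul_of_nonneg_left h4 F.2
    change (F : ℝ) * _ ≤ (F : ℝ) * _ at h7
    rw [hL]
    nlinarith
  · intro φ ψ h x
    have h1 := hK.conv_mono (hmem φ) (hmem ψ) (.of_forall fun y => clip_mono R (h y)) x
    have hφψ : φ x ≤ ψ x := h x
    have h2 := clip_mono R hφψ
    have h3 := abs_clip_sub_le R (ψ x) (φ x)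
    rw [abs_of_nonneg (by linarith), abs_of_nonneg (by linarith)] at h3
    have h4 := hF' (φ x) (ψ x)
    rw [abs_sub_comm (clip R _), abs_of_nonneg (sub_nonneg.2 h2)] at h4
    have h5 := (le_abs_self _).trans h4
    rw [hG, hG]
    have h6 := mul_le_mul_of_nonneg_left h1 hε
    have h7 := mul_le_mul_of_nonneg_left h3 (by positivity : 0 ≤ ε * m + F)
    nlinarith

end Truncation

section Limit

/-- A convergent function whose derivative converges has derivative tending to zero. -/
theorem eq_zero_of_tendsto_of_tendsto_deriv {g g' : ℝ → ℝ} {a l : ℝ}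
    (hg : ∀ t, 0 < t → HasDerivAt g (g' t) t) (ha : Tendsto g atTop (𝓝 a))
    (hl : Tendsto g' atTop (𝓝 l)) : l = 0 := by
  have h : ∀ n : ℕ, ∃ c : ℝ, (n : ℝ) + 1 < c ∧ g' c = g (n + 2) - g (n + 1) := by
    intro n
    have hn : (0 : ℝ) ≤ n := n.cast_nonneg
    obtain ⟨c, hc, hc'⟩ := exists_hasDerivAt_eq_slope g g' (a := (n : ℝ) + 1) (b := n + 2)
      (by linarith) (fun t ht => (hg t (by linarith [ht.1])).continuousAt.continuousWithinAt)
      (fun t ht => hg t (by linarith [ht.1]))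
    refine ⟨c, hc.1, ?_⟩
    rw [hc']
    norm_num
  choose c hc hc' using h
  have hctop : Tendsto c atTop atTop :=
    tendsto_atTop_mono (fun n => by linarith [hc n]) tendsto_natCast_atTop_atTop
  have h1 : Tendsto (fun n : ℕ => g (n + 2) - g (n + 1)) atTop (𝓝 (a - a)) :=
    (ha.comp (tendsto_atTop_add_const_right _ _ tendsto_natCast_atTop_atTop)).sub
      (ha.comp (tendsto_atTop_add_const_right _ _ tendsto_natCast_atTop_atTop))
  rw [sub_self] at h1
  exact tendsto_nhds_unique ((hl.comp hctop).congr hc') h1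

variable {Jinf f : ℝ → ℝ} {ε : ℝ}

/-- The right-hand side is continuous under bounded pointwise convergence. -/
theorem tendsto_rhs (hJ : IsKernel Jinf) (hf : IsOddBistable f) {φ : ℝ → C(UnitAddCircle, ℝ)}
    {U : UnitAddCircle → ℝ} {R : ℝ} (hφR : ∀ᶠ t in atTop, ∀ x, |φ t x| ≤ R)
    (hU : MemLp U ∞ volume) (hφ : ∀ x, Tendsto (fun t => φ t x) atTop (𝓝 (U x)))
    (x : UnitAddCircle) :
    Tendsto (fun t => rhs Jinf f ε (φ t) x) atTop (𝓝 (rhs Jinf f ε U x)) := by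
  have hK := hJ.isCircleKernel
  rw [show (fun t => rhs Jinf f ε (φ t) x) = _ from
    funext fun t => rhs_eq hJ f ε (memLp_top_of_continuous (φ t).continuous) x, rhs_eq hJ f ε hU]
  have hconv : Tendsto (fun t => circleConv (periodicKernel Jinf) (φ t) x) atTop
      (𝓝 (circleConv (periodicKernel Jinf) U x)) := by
    refine tendsto_integral_filter_of_dominated_convergence
      (fun y => periodicKernel Jinf (x - y) * R) ?_ ?_ ?_ ?_
    · exact .of_forall fun t =>
        (hK.integrable_mul (memLp_top_of_continuous (φ t).continuous) x).1
    · filter_upwards [hφR] with t ht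
      refine .of_forall fun y => ?_
      rw [norm_mul, Real.norm_of_nonneg (hK.nonneg _)]
      exact mul_le_mul_of_nonneg_left (ht y) (hK.nonneg _)
    · exact (hK.integrable.comp_sub_left x).mul_const R
    · exact .of_forall fun y => (hφ y).const_mul _
  exact ((hconv.sub ((hφ x).const_mul _)).const_mul _).add
    ((hf.differentiable.continuous.tendsto _).comp (hφ x))

/-- The limit of a bounded nondecreasing solution is a stationary solution. -/
theorem exists_stationary_limit (hJ : IsKernel Jinf) (hf : IsOddBistable f)
    (hε : deriv f 0 < ε * ∫ y, periodicKernel Jinf y) {w w' : ℝ → C(UnitAddCircle, ℝ)} {R : ℝ}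
    (hR : ∀ t, 0 ≤ t → ‖w t‖ ≤ R) (hmono : MonotoneOn w (Ici 0))
    (hw : ∀ t, 0 ≤ t → HasDerivWithinAt w (w' t) (Ici 0) t)
    (hw' : ∀ t, 0 ≤ t → ∀ x, w' t x = rhs Jinf f ε (w t) x) :
    ∃ U : C(UnitAddCircle, ℝ), (∀ x, rhs Jinf f ε U x = 0) ∧
      ∀ x, Tendsto (fun t => w t x) atTop (𝓝 (U x)) := by
  have hbd : ∀ t, 0 ≤ t → ∀ x, |w t x| ≤ R := fun t ht x =>
    ((w t).norm_coe_le_norm x).trans (hR t ht)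
  have hex : ∀ x, ∃ l, Tendsto (fun t => w t x) atTop (𝓝 l) := by
    intro x
    have hm : Monotone fun t => w (max t 0) x := fun s t hst =>
      hmono (mem_Ici.2 (le_max_right _ _)) (mem_Ici.2 (le_max_right _ _)) (max_le_max hst le_rfl) x
    have hb : BddAbove (range fun t => w (max t 0) x) := by
      refine ⟨R, ?_⟩
      rintro _ ⟨t, rfl⟩
      exact (le_abs_self _).trans (hbd _ (le_max_right _ _) x)
    refine ⟨_, (tendsto_atTop_ciSup hm hb).congr' ?_⟩
    filter_upwards [eventually_ge_atTop 0] with t ht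
    rw [max_eq_left ht]
  choose U hU using hex
  have hUmem : MemLp U ∞ volume := by
    refine memLp_top_of_bound ?_ R (.of_forall fun x => ?_)
    · exact aestronglyMeasurable_of_tendsto_ae atTop (f := fun t => ⇑(w t))
        (fun t => (w t).continuous.aestronglyMeasurable) (.of_forall hU)
    · refine le_of_tendsto (hU x).norm ?_
      filter_upwards [eventually_ge_atTop 0] with t ht using hbd t ht x
  have hstat : ∀ x, rhs Jinf f ε U x = 0 := by
    intro x
    refine eq_zero_of_tendsto_of_tendsto_deriv (g := fun t => w t x) (g' := fun t => w' t x)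
      (fun t ht => ?_) (hU x) ?_
    · have h1 := (hw t ht.le).hasDerivAt (Ici_mem_nhds ht)
      exact (ContinuousMap.evalCLM ℝ x).hasFDerivAt.comp_hasDerivAt t h1
    · refine (tendsto_rhs (ε := ε) hJ hf (R := R) ?_ hUmem hU x).congr' ?_
      · filter_upwards [eventually_ge_atTop 0] with t ht using hbd t ht
      · filter_upwards [eventually_ge_atTop 0] with t ht using (hw' t ht x).symm
  exact ⟨⟨U, continuous_of_forall_rhs_eq_zero hJ hf hε hUmem hstat⟩, hstat, hU⟩

end Limit

section Stable

variable {Jinf f : ℝ → ℝ} {ε : ℝ}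

/-- On continuous functions the essential supremum of a difference is its maximum. -/
theorem norm_toLp_sub {u : State} {v : C(UnitAddCircle, ℝ)} (huv : u =ᵐ[volume] v)
    (φ : C(UnitAddCircle, ℝ)) :
    ‖ContinuousMap.toLp (E := ℝ) ∞ volume ℝ φ - u‖ = ‖φ - v‖ := by
  have hφ := ContinuousMap.coeFn_toLp (p := ∞) (𝕜 := ℝ) volume φ
  refine le_antisymm ?_ ?_
  · refine State.norm_sub_le _ _ (norm_nonneg _) ?_
    filter_upwards [huv, hφ] with x h1 h2
    rw [h1, h2]
    exact (φ - v).norm_coe_le_norm x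
  · set c := ‖ContinuousMap.toLp (E := ℝ) ∞ volume ℝ φ - u‖ with hc
    rw [ContinuousMap.norm_le _ (norm_nonneg _)]
    have h : (fun x => max |φ x - v x| c) =ᵐ[volume] fun _ => c := by
      filter_upwards [huv, hφ, State.ae_abs_sub_le_norm (ContinuousMap.toLp (E := ℝ) ∞ volume ℝ φ) u]
        with x h1 h2 h3
      rw [h1, h2] at h3
      exact max_eq_right h3
    have h' := (Continuous.ae_eq_iff_eq volume (by fun_prop) continuous_const).1 h
    exact fun x => max_eq_right_iff.1 (congr_fun h' x)

theorem rhs_congr {φ ψ : UnitAddCircle → ℝ} (h : φ =ᵐ[volume] ψ) {x : UnitAddCircle}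
    (hx : φ x = ψ x) : rhs Jinf f ε φ x = rhs Jinf f ε ψ x := by
  rw [rhs, rhs, hx]
  congr 2
  refine integral_congr_ae ?_
  filter_upwards [h] with y hy
  rw [hy]

/-- If a stationary solution is stable, then arbitrarily close to it there are stationary solutions
above any subsolution which is close enough. -/
theorem IsStable.exists_stationary_ge (hJ : IsKernel Jinf) (hf : IsOddBistable f) (hε0 : 0 ≤ ε)
    (hε : deriv f 0 < ε * ∫ y, periodicKernel Jinf y) {u : State} {v : C(UnitAddCircle, ℝ)}
    (huv : u =ᵐ[volume] v) (hu : IsStable Jinf f ε u) {η : ℝ} (hη : 0 < η) :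
    ∃ δ > 0, ∀ M : C(UnitAddCircle, ℝ), (∀ x, 0 ≤ rhs Jinf f ε M x) → ‖M - v‖ < δ →
      ∃ U : C(UnitAddCircle, ℝ), (∀ x, rhs Jinf f ε U x = 0) ∧ M ≤ U ∧ ‖U - v‖ ≤ η := by
  obtain ⟨δ, hδ, hstab⟩ := hu (η / 2) (half_pos hη)
  refine ⟨min δ η, lt_min hδ hη, fun M hM hMv => ?_⟩
  set R := ‖v‖ + η with hRdef
  have hR0 : 0 ≤ R := by positivity
  obtain ⟨G, C, L, K, hG, hGlip, hGbd, hK, hGmono⟩ := exists_truncated_field hJ hf hε0 hR0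
  have hGeq : ∀ φ : C(UnitAddCircle, ℝ), ‖φ - v‖ ≤ η → ‖φ‖ ≤ R ∧
      ∀ x, G φ x = rhs Jinf f ε φ x := by
    intro φ h
    have h1 : ‖φ‖ ≤ R := by
      have := norm_add_le v (φ - v)
      rw [add_sub_cancel] at this
      linarith
    refine ⟨h1, fun x => ?_⟩
    rw [hG]
    congr 1
    funext y
    exact clip_of_abs_le ((φ.norm_coe_le_norm y).trans h1)
  obtain ⟨w, hw0, hw⟩ := exists_global_solution hGlip hGbd M
  have hwc : ContinuousOn w (Ici 0) := fun t ht => (hw t ht).continuousWithinAt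
  have hnc : ContinuousOn (fun t => ‖w t - v‖) (Ici 0) := (hwc.sub continuousOn_const).norm
  -- by stability, the solution of the truncated equation never leaves the ball of radius `η`
  have hstay : ∀ t, 0 ≤ t → ‖w t - v‖ < η := by
    by_contra! hcon
    set S : Set ℝ := {t | t ∈ Ici 0 ∧ η ≤ ‖w t - v‖} with hS
    have hSne : S.Nonempty := hcon
    have hSc : IsClosed S := by
      have := hnc.preimage_isClosed_of_isClosed isClosed_Ici (isClosed_Ici (a := η))
      exact this
    have hSb : BddBelow S := ⟨0, fun t ht => ht.1⟩
    obtain ⟨hT0, hTη⟩ := hSc.csInf_mem hSne hSb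
    set T := sInf S with hT
    have hbefore : ∀ t ∈ Ico 0 T, ‖w t - v‖ < η := by
      intro t ht
      by_contra! h
      exact absurd (csInf_le hSb (show t ∈ S from ⟨ht.1, h⟩)) (not_le.2 ht.2)
    have hTpos : 0 < T := by
      refine lt_of_le_of_ne hT0 fun h => ?_
      rw [← h, hw0] at hTη
      exact absurd (hMv.trans_le (min_le_right _ _)) (not_lt.2 hTη)
    have hsol : IsSolutionOn Jinf f ε T fun t => ContinuousMap.toLp (E := ℝ) ∞ volume ℝ (w t) := by
      intro t ht
      refine ⟨ContinuousMap.toLp (E := ℝ) ∞ volume ℝ (G (w t)),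
        (ContinuousMap.toLp (E := ℝ) ∞ volume ℝ).hasFDerivAt.comp_hasDerivWithinAt t (hw t ht.1), ?_⟩
      have h1 := ContinuousMap.coeFn_toLp (p := ∞) (𝕜 := ℝ) volume (w t)
      filter_upwards [h1, ContinuousMap.coeFn_toLp (p := ∞) (𝕜 := ℝ) volume (G (w t))]
        with x h2 h3
      rw [h3, (hGeq _ (hbefore t ht).le).2, rhs_congr h1 h2]
    have hsmall : ∀ t ∈ Ico 0 T, ‖w t - v‖ < η / 2 := by
      intro t ht
      have := hstab T hTpos _ hsol (by
        rw [norm_toLp_sub huv, hw0]; exact hMv.trans_le (min_le_left _ _)) t ht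
      rwa [norm_toLp_sub huv] at this
    have hlim : ‖w T - v‖ ≤ η / 2 := by
      have h1 : Tendsto (fun t => ‖w t - v‖) (𝓝[<] T) (𝓝 ‖w T - v‖) :=
        ((hnc T hT0).continuousAt (Ici_mem_nhds hTpos)).tendsto.mono_left nhdsWithin_le_nhds
      refine le_of_tendsto h1 ?_
      filter_upwards [Ico_mem_nhdsLT hTpos] with t ht using (hsmall t ht).le
    linarith
  have hwmono : MonotoneOn w (Ici 0) := by
    refine monotoneOn_of_subsolution hGlip hK hGmono hw ?_
    intro x
    rw [hw0]
    change 0 ≤ G M x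
    rw [(hGeq M (hMv.le.trans (min_le_right _ _))).2]
    exact hM x
  obtain ⟨U, hU, hUlim⟩ := exists_stationary_limit hJ hf hε (w := w) (w' := fun t => G (w t))
    (fun t ht => (hGeq _ (hstay t ht).le).1) hwmono hw (fun t ht => (hGeq _ (hstay t ht).le).2)
  refine ⟨U, hU, fun x => ?_, ?_⟩
  · change M x ≤ U x
    refine ge_of_tendsto (hUlim x) ?_
    filter_upwards [eventually_ge_atTop 0] with t ht
    have : w 0 x ≤ w t x := hwmono self_mem_Ici ht ht x
    rwa [hw0] at this
  · rw [ContinuousMap.norm_le _ hη.le]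
    intro x
    refine le_of_tendsto ((hUlim x).sub_const (v x)).norm ?_
    filter_upwards [eventually_ge_atTop 0] with t ht
    exact ((w t - v).norm_coe_le_norm x).trans (hstay t ht).le

end Stable

/-! ### Instability above the threshold -/

section Instability

variable {Jinf f : ℝ → ℝ} {ε : ℝ}

theorem eq_of_le_of_integral_eq {φ ψ : C(UnitAddCircle, ℝ)} (h : φ ≤ ψ)
    (hi : ∫ x, φ x = ∫ x, ψ x) : φ = ψ := by
  have hφ := integrable_of_memLp_top (memLp_top_of_continuous φ.continuous)
  have hψ := integrable_of_memLp_top (memLp_top_of_continuous ψ.continuous)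
  have h1 : ∫ x, (ψ x - φ x) = 0 := by rw [integral_sub hψ hφ, hi, sub_self]
  have h2 : (fun x => ψ x - φ x) =ᵐ[volume] fun _ => 0 :=
    (integral_eq_zero_iff_of_nonneg (fun x => sub_nonneg.2 (h x)) (hψ.sub hφ)).1 h1
  have h3 := (Continuous.ae_eq_iff_eq volume (by fun_prop) continuous_const).1 h2
  ext x
  have h4 : ψ x - φ x = 0 := congr_fun h3 x
  linarith

theorem rhs_le_rhs_of_le (hJ : IsKernel Jinf) (hε : 0 ≤ ε) {φ ψ : C(UnitAddCircle, ℝ)} (h : φ ≤ ψ)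
    {x : UnitAddCircle} (hx : φ x = ψ x) : rhs Jinf f ε φ x ≤ rhs Jinf f ε ψ x := by
  have hφ := memLp_top_of_continuous φ.continuous
  have hψ := memLp_top_of_continuous ψ.continuous
  rw [rhs_eq hJ f ε hφ, rhs_eq hJ f ε hψ, hx]
  have := hJ.isCircleKernel.conv_mono hφ hψ (.of_forall h) x
  have := mul_le_mul_of_nonneg_left this hε
  linarith

/-- The maximum of two stationary solutions is a subsolution. -/
theorem rhs_sup_nonneg (hJ : IsKernel Jinf) (hε : 0 ≤ ε) {φ ψ : C(UnitAddCircle, ℝ)}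
    (hφ : ∀ x, rhs Jinf f ε φ x = 0) (hψ : ∀ x, rhs Jinf f ε ψ x = 0) (x : UnitAddCircle) :
    0 ≤ rhs Jinf f ε (φ ⊔ ψ : C(UnitAddCircle, ℝ)) x := by
  rcases le_total (φ x) (ψ x) with h | h
  · rw [← hψ x]
    exact rhs_le_rhs_of_le hJ hε le_sup_right (max_eq_right h).symm
  · rw [← hφ x]
    exact rhs_le_rhs_of_le hJ hε le_sup_left (max_eq_left h).symm

/-- Two ordered stationary solutions coincide or are strictly ordered. -/
theorem lt_of_stationary_le (hJ : IsKernel Jinf) (hε : 0 < ε) {φ ψ : C(UnitAddCircle, ℝ)}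
    (hφ : ∀ x, rhs Jinf f ε φ x = 0) (hψ : ∀ x, rhs Jinf f ε ψ x = 0) (h : φ ≤ ψ) (hne : φ ≠ ψ)
    (x : UnitAddCircle) : φ x < ψ x := by
  have hφ' := memLp_top_of_continuous φ.continuous
  have hψ' := memLp_top_of_continuous ψ.continuous
  have hK := hJ.isCircleKernel
  have key := hK.forall_eq_zero_or_forall_pos (d := fun x => ψ x - φ x) (by fun_prop)
    (fun x => sub_nonneg.2 (h x)) (fun x hx => ?_)
  · rcases key with h0 | h0
    · exact absurd (ContinuousMap.ext fun x => (sub_eq_zero.1 (h0 x)).symm) hne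
    · exact sub_pos.1 (h0 x)
  · have h1 := hφ x
    have h2 := hψ x
    rw [rhs_eq hJ f ε hφ'] at h1
    rw [rhs_eq hJ f ε hψ', sub_eq_zero.1 hx] at h2
    rw [hK.conv_sub hψ' hφ']
    have h3 : ε * (circleConv (periodicKernel Jinf) ψ x -
        circleConv (periodicKernel Jinf) φ x) = 0 := by linarith
    exact (mul_eq_zero.1 h3).resolve_left hε.ne'

/-- The translates of a continuous function, as a continuous family. -/
noncomputable def translate (v : C(UnitAddCircle, ℝ)) : C(UnitAddCircle, C(UnitAddCircle, ℝ)) :=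
  ContinuousMap.curry ⟨fun p : UnitAddCircle × UnitAddCircle => v (p.2 + p.1), by fun_prop⟩

@[simp]
theorem translate_apply (v : C(UnitAddCircle, ℝ)) (s x : UnitAddCircle) :
    translate v s x = v (x + s) := rfl

theorem translate_zero (v : C(UnitAddCircle, ℝ)) : translate v 0 = v := by
  ext x; simp

theorem rhs_translate (hJ : IsKernel Jinf) (v : C(UnitAddCircle, ℝ)) (s x : UnitAddCircle) :
    rhs Jinf f ε (translate v s) x = rhs Jinf f ε v (x + s) := by
  rw [rhs_eq hJ f ε (memLp_top_of_continuous (translate v s).continuous),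
    rhs_eq hJ f ε (memLp_top_of_continuous v.continuous), ← IsCircleKernel.conv_translate]
  rfl

theorem integral_translate (v : C(UnitAddCircle, ℝ)) (s : UnitAddCircle) :
    ∫ x, translate v s x = ∫ x, v x :=
  integral_add_right_eq_self (fun x => v x) s

/-- A nonconstant function has arbitrarily close translates different from itself. -/
theorem exists_translate_ne {v : C(UnitAddCircle, ℝ)} {x y : UnitAddCircle} (hxy : v x ≠ v y)
    {δ : ℝ} (hδ : 0 < δ) : ∃ r, translate v r ≠ v ∧ ‖translate v r - v‖ < δ := by
  by_contra! hcon
  have hnear : ∀ᶠ r in 𝓝 (0 : UnitAddCircle), translate v r = v := by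
    have h1 := (translate v).continuous.tendsto 0
    rw [translate_zero] at h1
    filter_upwards [Metric.tendsto_nhds.1 h1 δ hδ] with r hr
    by_contra hne
    rw [dist_eq_norm] at hr
    exact absurd hr (not_lt.2 (hcon r hne))
  have hloc : IsLocallyConstant (translate v) := by
    rw [IsLocallyConstant.iff_eventually_eq]
    intro s
    have h2 : Tendsto (fun s' => s' - s) (𝓝 s) (𝓝 0) := by
      simpa using (continuous_id.sub continuous_const).tendsto (f := fun s' => s' - s) s
    filter_upwards [h2.eventually hnear] with s' hs'
    ext z
    have h3 := DFunLike.congr_fun hs' (z + s)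
    rw [translate_apply, add_add_sub_cancel] at h3
    simpa using h3
  have h4 := DFunLike.congr_fun (hloc.apply_eq_of_preconnectedSpace 0 (y - x)) x
  simp only [translate_apply, add_zero, add_sub_cancel] at h4
  exact hxy h4

/-- Sliding: a stationary solution above a stationary solution `v`, and different from all its
translates, lies above all translates of `v`. -/
theorem translate_le_of_le (hJ : IsKernel Jinf) (hε : 0 < ε) {v U : C(UnitAddCircle, ℝ)}
    (hv : ∀ x, rhs Jinf f ε v x = 0) (hU : ∀ x, rhs Jinf f ε U x = 0) (h : v ≤ U)
    (hne : ∀ s, translate v s ≠ U) (s : UnitAddCircle) : translate v s ≤ U := by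
  set P : Set UnitAddCircle := {s | translate v s ≤ U} with hP
  have hclosed : IsClosed P := by
    have : P = ⋂ x, {s | translate v s x ≤ U x} := by
      ext s
      simp only [mem_iInter]
      rfl
    rw [this]
    refine isClosed_iInter fun x => isClosed_le ?_ continuous_const
    simp only [translate_apply]
    fun_prop
  have hopen : IsOpen P := by
    rw [isOpen_iff_mem_nhds]
    intro s hs
    have hlt := lt_of_stationary_le hJ hε (fun x => by rw [rhs_translate hJ, hv]) hU hs (hne s)
    obtain ⟨x₀, -, hx₀⟩ := (isCompact_univ (X := UnitAddCircle)).exists_isMinOn univ_nonempty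
      (U - translate v s).continuous.continuousOn
    have hpos : 0 < U x₀ - translate v s x₀ := sub_pos.2 (hlt x₀)
    filter_upwards [Metric.tendsto_nhds.1 ((translate v).continuous.tendsto s) _ hpos] with s' hs'
    intro x
    change translate v s' x ≤ U x
    have h1 : U x₀ - translate v s x₀ ≤ U x - translate v s x := hx₀ (mem_univ x)
    rw [dist_eq_norm] at hs'
    have h2 : translate v s' x - translate v s x < _ :=
      ((le_abs_self _).trans ((translate v s' - translate v s).norm_coe_le_norm x)).trans_lt hs'
    linarith
  have huniv : P = univ := IsClopen.eq_univ ⟨hclosed, hopen⟩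
    ⟨0, by change translate v 0 ≤ U; rwa [translate_zero]⟩
  have : s ∈ P := huniv ▸ mem_univ s
  exact this

/-- Above the threshold, a nonconstant stationary solution is unstable. -/
theorem not_isStable_of_nonconstant (hJ : IsKernel Jinf) (hf : IsOddBistable f) (hε0 : 0 < ε)
    (hε : deriv f 0 < ε * ∫ y, periodicKernel Jinf y) {u : State} {v : C(UnitAddCircle, ℝ)}
    (huv : u =ᵐ[volume] v) (hv : ∀ x, rhs Jinf f ε v x = 0) {x y : UnitAddCircle}
    (hxy : v x < v y) : ¬ IsStable Jinf f ε u := by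
  intro hstab
  obtain ⟨δ, hδ, H⟩ := hstab.exists_stationary_ge hJ hf hε0.le hε huv
    (show 0 < (v y - v x) / 2 by linarith)
  obtain ⟨r, hr, hrδ⟩ := exists_translate_ne hxy.ne hδ
  have hvr : ∀ z, rhs Jinf f ε (translate v r) z = 0 := fun z => by rw [rhs_translate hJ, hv]
  obtain ⟨U, hU, hMU, hUv⟩ := H (v ⊔ translate v r) (rhs_sup_nonneg hJ hε0.le hv hvr) (by
    refine lt_of_le_of_lt ?_ hrδ
    rw [ContinuousMap.norm_le _ (norm_nonneg _)]
    intro z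
    have h1 := (translate v r - v).norm_coe_le_norm z
    refine le_trans ?_ h1
    change |max (v z) (translate v r z) - v z| ≤ |translate v r z - v z|
    rcases le_total (v z) (translate v r z) with h | h
    · rw [max_eq_right h]
    · rw [max_eq_left h, sub_self, abs_zero]
      exact abs_nonneg _)
  have hvU : v ≤ U := le_sup_left.trans hMU
  have hne : ∀ s, translate v s ≠ U := by
    -- a translate has the same integral as `v`, whereas that of `U` is larger
    intro s hs
    have h1 : v = U := eq_of_le_of_integral_eq hvU (by rw [← hs, integral_translate])
    have h2 : translate v r ≤ v := (le_sup_right.trans hMU).trans h1.ge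
    exact hr (eq_of_le_of_integral_eq h2 (integral_translate v r))
  have h1 : v (x + (y - x)) ≤ U x := translate_le_of_le hJ hε0 hv hU hvU hne (y - x) x
  rw [add_sub_cancel] at h1
  have h2 : U x - v x ≤ _ := (le_abs_self _).trans (((U - v).norm_coe_le_norm x).trans hUv)
  linarith

/-- Above the threshold, the zero solution is unstable. -/
theorem not_isStable_of_eq_zero (hJ : IsKernel Jinf) (hf : IsOddBistable f) (hε0 : 0 < ε)
    (hε : deriv f 0 < ε * ∫ y, periodicKernel Jinf y) {u : State}
    (hu : u =ᵐ[volume] (0 : C(UnitAddCircle, ℝ))) : ¬ IsStable Jinf f ε u := by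
  intro hstab
  have hK := hJ.isCircleKernel
  obtain ⟨ρ, hρ, c, hc0, -, hc⟩ := hf.exists_mul_le_map hf.deriv_zero_pos
  have hfpos : ∀ v, 0 < v → v ≤ c → 0 < f v := fun v h0 h1 => by
    have h2 := hc v ⟨h0.le, h1⟩
    have h3 := mul_pos hρ h0
    linarith
  obtain ⟨δ, hδ, H⟩ := hstab.exists_stationary_ge hJ hf hε0.le hε hu hc0
  set d := min (δ / 2) c with hd
  have hd0 : 0 < d := lt_min (half_pos hδ) hc0
  obtain ⟨U, hU, hMU, hUv⟩ := H (ContinuousMap.const _ d) (fun x => by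
      rw [rhs_eq hJ f ε (memLp_top_of_continuous (ContinuousMap.continuous _))]
      have : circleConv (periodicKernel Jinf) (ContinuousMap.const UnitAddCircle d) x = _ :=
        IsCircleKernel.conv_const d x
      rw [this]
      have := hfpos d hd0 (min_le_right _ _)
      simpa using this.le) (by
    refine lt_of_le_of_lt ?_ (half_lt_self hδ)
    rw [ContinuousMap.norm_le _ (half_pos hδ).le]
    intro x
    have : |d| ≤ δ / 2 := by rw [abs_of_pos hd0]; exact min_le_left _ _
    simpa using this)
  obtain ⟨x₀, -, hx₀⟩ := (isCompact_univ (X := UnitAddCircle)).exists_isMinOn univ_nonempty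
    U.continuous.continuousOn
  -- at a minimum of `U` both terms of the right-hand side are nonnegative and the second is positive
  have h1 : d ≤ U x₀ := hMU x₀
  have h2 : U x₀ ≤ c := by
    rw [sub_zero] at hUv
    exact (le_abs_self _).trans ((U.norm_coe_le_norm x₀).trans hUv)
  have h3 := hfpos _ (hd0.trans_le h1) h2
  have hUm := memLp_top_of_continuous U.continuous
  have h4 := hK.conv_mono (memLp_const (U x₀)) hUm (.of_forall fun y => hx₀ (mem_univ y)) x₀
  rw [IsCircleKernel.conv_const] at h4
  have h5 := hU x₀
  rw [rhs_eq hJ f ε hUm] at h5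
  have h6 := mul_nonneg hε0.le (sub_nonneg.2 h4)
  linarith

/-- Above the threshold, antisymmetric stationary solutions are unstable. -/
theorem not_isStable_of_antisymm (hJ : IsKernel Jinf) (hf : IsOddBistable f)
    (hε : deriv f 0 < ε * ∫ y, periodicKernel Jinf y) {u : State}
    (hu : IsStationary Jinf f ε u) (hodd : ∀ᵐ x, u (-x) = -u x) : ¬ IsStable Jinf f ε u := by
  have hε0 : 0 < ε :=
    pos_of_mul_pos_left (hf.deriv_zero_pos.trans hε) hJ.isCircleKernel.mass_pos.le
  obtain ⟨v, huv, hv⟩ := hu.exists_continuousMap hJ hf hε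
  by_cases hconst : ∃ x y, v x < v y
  · obtain ⟨x, y, hxy⟩ := hconst
    exact not_isStable_of_nonconstant hJ hf hε0 hε huv hv hxy
  · push Not at hconst
    have hv0 : v = 0 := by
      ext x
      have h1 := neg_apply_of_ae_antisymm v.continuous huv hodd x
      have h2 : v (-x) = v x := le_antisymm (hconst x (-x)) (hconst (-x) x)
      change v x = 0
      linarith
    exact not_isStable_of_eq_zero hJ hf hε0 hε (hv0 ▸ huv)

end Instability

section Ordering

variable {Jinf f : ℝ → ℝ}

/-- The common threshold is `f' 0 / m`, with `m` the mass of the kernel: the branch is discontinuous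
below it, and both continuous and unstable above it. -/
theorem IsZeroMeanOneInterfaceBranch.exists_stabilisationValue_le_discontinuityValue
    (hJ : IsKernel Jinf) (hf : IsOddBistable f) {I : Set ℝ} {u : ℝ → State}
    (hu : IsZeroMeanOneInterfaceBranch Jinf f I u) :
    ∃ e_s e_d : ℝ, IsStabilisationValue Jinf f I u e_s ∧ IsDiscontinuityValue I u e_d ∧
      e_s ≤ e_d := by
  have hm := hJ.isCircleKernel.mass_pos
  set m := ∫ y, periodicKernel Jinf y with hmdef
  set D : Set ℝ := {ε ∈ I | IsDiscontinuous (u ε)} with hD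
  set S : Set ℝ := {ε ∈ I | IsStable Jinf f ε (u ε)} with hS
  have hlow : ∀ ε ∈ I, ε < deriv f 0 / m → ε ∈ D := fun ε hε h =>
    ⟨hε, hu.isDiscontinuous hJ hf hε ((lt_div_iff₀ hm).1 h)⟩
  have hDle : ∀ ε ∈ D, ε ≤ deriv f 0 / m := by
    intro ε hε
    by_contra! h
    obtain ⟨v, huv, -⟩ := (hu.stationary ε hε.1).exists_continuousMap hJ hf ((div_lt_iff₀ hm).1 h)
    exact hε.2 ⟨v, v.continuous, huv⟩
  have hSle : ∀ ε ∈ S, ε ≤ deriv f 0 / m := by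
    intro ε hε
    by_contra! h
    exact not_isStable_of_antisymm hJ hf ((div_lt_iff₀ hm).1 h) (hu.stationary ε hε.1)
      (hu.antisymm ε hε.1) hε.2
  have hD0 : (0 : ℝ) ∈ D := hlow 0 hu.zero_mem (div_pos hf.deriv_zero_pos hm)
  have hS0 : (0 : ℝ) ∈ S := ⟨hu.zero_mem, isStable_zero hf hu.start⟩
  have hDlub := isLUB_csSup ⟨0, hD0⟩ ⟨_, hDle⟩
  have hSlub := isLUB_csSup ⟨0, hS0⟩ ⟨_, hSle⟩
  refine ⟨sSup S, sSup D, hSlub, ⟨hDlub, fun ε hε h => ?_⟩, hSlub.2 fun ε hε => ?_⟩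
  · obtain ⟨e, he, hεe⟩ := exists_lt_of_lt_csSup ⟨0, hD0⟩ h
    exact (hlow ε hε (hεe.trans_le (hDle e he))).2
  · refine le_of_forall_lt_imp_le_of_dense fun e he => ?_
    rcases lt_or_ge e 0 with h0 | h0
    · exact h0.le.trans (hDlub.1 hD0)
    · exact hDlub.1 (hlow e (hu.ordConnected.out hu.zero_mem hε.1 ⟨h0, he.le⟩)
        (he.trans_le (hSle ε hε)))

end Ordering

end NonlocalBistable

theorem mainTheorem4 (Jinf f : ℝ → ℝ) (hJ : NonlocalBistable.IsKernel Jinf)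
    (hf : NonlocalBistable.IsOddBistable f) (I : Set ℝ) (u : ℝ → NonlocalBistable.State)
    (hu : NonlocalBistable.IsZeroMeanOneInterfaceBranch Jinf f I u) :
    ∃ e_s e_d : ℝ, NonlocalBistable.IsStabilisationValue Jinf f I u e_s ∧
      NonlocalBistable.IsDiscontinuityValue I u e_d ∧ e_s ≤ e_d :=
  hu.exists_stabilisationValue_le_discontinuityValue hJ hf
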